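/- Let $K$ be a field, $A$ a unital associative $K$-algebra, and $S$ an inverse monoid, with set of idempotents $E(S)$ and natural partial order $s\le t\iff s=et$ for some $e\in E(S)$. Let $\theta$ be a unital action of $S$ on $A$, that is, a homomorphism $s\mapsto\theta_s$ from $S$ to the monoid of partial bijections of $A$ with $\theta_1=\mathrm{id}_A$ such that, for every $s\in S$, the range of $\theta_s$ is the ideal $1_sA$ for some central idempotent $1_s\in A$ (so its domain is $1_{s^{-1}}A$), and $\theta_s\colon 1_{s^{-1}}A\to 1_sA$ is an isomorphism of $K$-algebras. Let $A\rtimes_\theta S$ be the crossed product: the quotient of $\bigoplus_{s\in S}1_sA\,\delta_s$, with product $a\delta_s\cdot b\delta_t=a\,\theta_s(1_{s^{-1}}b)\,\delta_{st}$, by the two-sided ideal generated by all $a\delta_s-a\delta_t$ with $s\le t$ and $a\in 1_sA$; write $\overline{w}$ for the class of $w$. For a left module $V$ over the monoid algebra $KS$ put $H_n(S,V)=\operatorname{Tor}^{KS}_n(KE(S),V)$, where $KE(S)$ is the free $K$-module on $E(S)$, with the right $KS$-action $e\cdot s=s^{-1}es$. For a $K$-algebra $R$, with $R^e=R\otimes_KR^{\mathrm{op}}$,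 and an $R$-bimodule $M$ put $H_n(R,M)=\operatorname{Tor}^{R^e}_n(R,M)$ (Hochschild homology). Assume that $A$ is separable over $K$, i.e. $A$ is projective as a left $A^e$-module. Let $M$ be an $A\rtimes_\theta S$-bimodule (on which the two induced $K$-actions agree), regarded as an $A$-bimodule via $a\mapsto\overline{a\delta_1}$, and let $[A,M]$ be the $K$-submodule of $M$ generated by all $ax-xa$ with $a\in A$, $x\in M$. Then $[A,M]$ is stable under the left $S$-action $s\cdot x=\overline{1_s\delta_s}\,x\,\overline{1_{s^{-1}}\delta_{s^{-1}}}$, so $M/[A,M]$ is a left $KS$-module, and for every $n\ge 0$ there is an isomorphism of $K$-vector spaces $$H_n(S,\,M/[A,M])\;\cong\;H_n(A\rtimes_\theta S,\,M).$$ -/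

import Mathlib

open CategoryTheory MulOpposite
open scoped TensorProduct

universe u

/-! ## Inverse monoids -/

/-- An inverse monoid: every `s` has a unique inverse `s⁻¹`, i.e. a unique element with
`s s⁻¹ s = s` and `s⁻¹ s s⁻¹ = s⁻¹`. -/
class InverseMonoid (S : Type u) extends Monoid S, Inv S where
  mul_inv_mul : ∀ s : S, s * s⁻¹ * s = s
  inv_mul_inv : ∀ s : S, s⁻¹ * s * s⁻¹ = s⁻¹
  eq_inv : ∀ s t : S, s * t * s = s → t * s * t = t → t = s⁻¹

namespace InverseMonoid

variable {S : Type u} [InverseMonoid S]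

/-- The natural partial order: `s ≤ t` iff `s = e t` for some idempotent `e`. -/
def NatLE (s t : S) : Prop := ∃ e : S, IsIdempotentElem e ∧ s = e * t

theorem inv_inv' (s : S) : s⁻¹⁻¹ = s :=
  (eq_inv s⁻¹ s (inv_mul_inv s) (mul_inv_mul s)).symm

theorem inv_idem {e : S} (he : IsIdempotentElem e) : e⁻¹ = e := by
  have h : e * e = e := he
  exact (eq_inv e e (by rw [h, h]) (by rw [h, h])).symm

theorem one_inv : (1 : S)⁻¹ = 1 := inv_idem (one_mul 1)

theorem idem_mul {e f : S} (he : IsIdempotentElem e) (hf : IsIdempotentElem f) :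
    IsIdempotentElem (e * f) := by
  have he' : e * e = e := he
  have hf' : f * f = f := hf
  set x := (e * f)⁻¹ with hx
  have h1 : e * f * x * (e * f) = e * f := mul_inv_mul _
  have h2 : x * (e * f) * x = x := inv_mul_inv _
  have key : f * x * e = x := by
    apply eq_inv
    · calc e * f * (f * x * e) * (e * f) = e * (f * f) * x * ((e * e) * f) := by
            simp only [mul_assoc]
        _ = e * f := by rw [he', hf', h1]
    · calc f * x * e * (e * f) * (f * x * e) = f * (x * ((e * e) * (f * f)) * x) * e := by
            simp only [mul_assoc]
        _ = f * x * e := by rw [he', hf', h2]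
  have hxi : x * x = x := by
    calc x * x = f * x * e * (f * x * e) := by rw [key]
      _ = f * (x * (e * f) * x) * e := by simp only [mul_assoc]
      _ = x := by rw [h2, key]
  have : e * f = x := by
    rw [← inv_inv' (e * f), ← hx, inv_idem hxi]
  rw [this]; exact hxi

theorem idem_comm {e f : S} (he : IsIdempotentElem e) (hf : IsIdempotentElem f) :
    e * f = f * e := by
  have he' : e * e = e := he
  have hf' : f * f = f := hf
  have h1 : e * f * (e * f) = e * f := idem_mul he hf
  have h2 : f * e * (f * e) = f * e := idem_mul hf he
  have : f * e = (e * f)⁻¹ := by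
    apply eq_inv
    · calc e * f * (f * e) * (e * f) = e * (f * f) * ((e * e) * f) := by simp only [mul_assoc]
        _ = e * f := by rw [he', hf', h1]
    · calc f * e * (e * f) * (f * e) = f * (e * e) * ((f * f) * e) := by simp only [mul_assoc]
        _ = f * e := by rw [he', hf', h2]
  rw [this, inv_idem (idem_mul he hf)]

theorem mul_inv_idem (s : S) : IsIdempotentElem (s * s⁻¹) := by
  show s * s⁻¹ * (s * s⁻¹) = s * s⁻¹
  rw [← mul_assoc, mul_inv_mul]

theorem inv_mul_idem (s : S) : IsIdempotentElem (s⁻¹ * s) := by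
  show s⁻¹ * s * (s⁻¹ * s) = s⁻¹ * s
  rw [← mul_assoc, inv_mul_inv]

theorem mul_inv_rev' (s t : S) : (s * t)⁻¹ = t⁻¹ * s⁻¹ := by
  have hc : t * t⁻¹ * (s⁻¹ * s) = s⁻¹ * s * (t * t⁻¹) :=
    idem_comm (mul_inv_idem t) (inv_mul_idem s)
  refine (eq_inv _ _ ?_ ?_).symm
  · calc s * t * (t⁻¹ * s⁻¹) * (s * t) = s * (t * t⁻¹ * (s⁻¹ * s)) * t := by
          simp only [mul_assoc]
      _ = s * s⁻¹ * s * (t * t⁻¹ * t) := by rw [hc]; simp only [mul_assoc]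
      _ = s * t := by rw [mul_inv_mul, mul_inv_mul]
  · calc t⁻¹ * s⁻¹ * (s * t) * (t⁻¹ * s⁻¹) = t⁻¹ * (s⁻¹ * s * (t * t⁻¹)) * s⁻¹ := by
          simp only [mul_assoc]
      _ = t⁻¹ * t * t⁻¹ * (s⁻¹ * s * s⁻¹) := by rw [← hc]; simp only [mul_assoc]
      _ = t⁻¹ * s⁻¹ := by rw [inv_mul_inv, inv_mul_inv]

theorem conj_idem (s : S) {e : S} (he : IsIdempotentElem e) :
    IsIdempotentElem (s⁻¹ * e * s) := by
  have he' : e * e = e := he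
  show s⁻¹ * e * s * (s⁻¹ * e * s) = s⁻¹ * e * s
  calc s⁻¹ * e * s * (s⁻¹ * e * s) = s⁻¹ * (e * (s * s⁻¹)) * e * s := by simp only [mul_assoc]
    _ = s⁻¹ * s * s⁻¹ * (e * e) * s := by
      rw [idem_comm he (mul_inv_idem s)]; simp only [mul_assoc]
    _ = s⁻¹ * e * s := by rw [inv_mul_inv, he']

end InverseMonoid

open InverseMonoid

/-! ## Tensor products and Tor over a possibly noncommutative algebra -/

section Tor

variable (K : Type u) [CommRing K] (R : Type u) [Ring R] [Algebra K R]

/-- The submodule of `X ⊗[K] Y` generated by the elements `x r ⊗ y - x ⊗ r y`, for a right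
`R`-module `X` and a left `R`-module `Y`. -/
def balancedRelations (X Y : Type u) [AddCommGroup X] [Module K X] [Module Rᵐᵒᵖ X]
    [AddCommGroup Y] [Module K Y] [Module R Y] : Submodule K (X ⊗[K] Y) :=
  Submodule.span K {z | ∃ (x : X) (r : R) (y : Y), z = (op r • x) ⊗ₜ[K] y - x ⊗ₜ[K] (r • y)}

/-- The tensor product `X ⊗_R Y` of a right and a left module over a `K`-algebra `R`. -/
abbrev BalancedTensor (X Y : Type u) [AddCommGroup X] [Module K X] [Module Rᵐᵒᵖ X]
    [AddCommGroup Y] [Module K Y] [Module R Y] : Type u :=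
  (X ⊗[K] Y) ⧸ balancedRelations K R X Y

/-- The `K`-linear map `X ⊗_R f : X ⊗_R Y → X ⊗_R Z` induced by an `R`-linear map `f`. -/
noncomputable def BalancedTensor.map (X : Type u) [AddCommGroup X] [Module K X] [Module Rᵐᵒᵖ X]
    {Y Z : Type u} [AddCommGroup Y] [Module K Y] [Module R Y] [IsScalarTower K R Y]
    [AddCommGroup Z] [Module K Z] [Module R Z] [IsScalarTower K R Z] (f : Y →ₗ[R] Z) :
    BalancedTensor K R X Y →ₗ[K] BalancedTensor K R X Z :=
  Submodule.mapQ _ _ (LinearMap.lTensor X (f.restrictScalars K)) <| by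
    refine Submodule.span_le.2 ?_
    rintro _ ⟨x, r, y, rfl⟩
    refine Submodule.subset_span ⟨x, r, f y, ?_⟩
    simp [map_sub]

/-- The `K`-module underlying a module over a `K`-algebra. -/
@[reducible] def algebraModule (Y : ModuleCat.{u} R) : Module K Y :=
  Module.compHom Y (algebraMap K R)

theorem algebraModule_isScalarTower (Y : ModuleCat.{u} R) :
    letI := algebraModule K R Y
    IsScalarTower K R Y :=
  letI := algebraModule K R Y
  ⟨fun k r y => by
    rw [Algebra.smul_def, mul_smul]; rfl⟩

variable (X : Type u) [AddCommGroup X] [Module K X] [Module Rᵐᵒᵖ X] [IsScalarTower K Rᵐᵒᵖ X]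

attribute [local instance] algebraModule algebraModule_isScalarTower in
/-- The functor `X ⊗_R - : R-Mod ⥤ K-Mod`, for a right `R`-module `X`. -/
noncomputable def balancedTensorFunctor : ModuleCat.{u} R ⥤ ModuleCat.{u} K where
  obj Y := ModuleCat.of K (BalancedTensor K R X Y)
  map f := ModuleCat.ofHom (BalancedTensor.map K R X f.hom)
  map_id Y := by
    ext : 1
    refine Submodule.linearMap_qext _ (TensorProduct.ext' fun x y => ?_)
    rfl
  map_comp f g := by
    ext : 1
    refine Submodule.linearMap_qext _ (TensorProduct.ext' fun x y => ?_)
    rfl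

attribute [local instance] algebraModule algebraModule_isScalarTower in
instance balancedTensorFunctor_additive : (balancedTensorFunctor K R X).Additive where
  map_add {Y Z f g} := by
    ext : 1
    refine Submodule.linearMap_qext _ (TensorProduct.ext' fun x y => ?_)
    show Submodule.Quotient.mk (x ⊗ₜ[K] (f.hom y + g.hom y)) = _
    rw [TensorProduct.tmul_add]
    rfl

/-- `Tor_n^R(X, Y)` as a `K`-module: the `n`-th left derived functor of `X ⊗_R -` at `Y`. -/
noncomputable def algebraTor (n : ℕ) (Y : ModuleCat.{u} R) : ModuleCat.{u} K :=
  ((balancedTensorFunctor K R X).leftDerived n).obj Y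

end Tor

/-! ## Enveloping algebra, Hochschild homology, separability -/

section Hochschild

variable (K : Type u) [CommRing K] (R : Type u) [Ring R] [Algebra K R]

/-- The enveloping algebra `R ⊗ Rᵒᵖ`. -/
abbrev Env : Type u := R ⊗[K] Rᵐᵒᵖ

/-- A bimodule `M` as a left module over the enveloping algebra: `(a ⊗ b) x = a x b`. -/
@[reducible] noncomputable def envLeftModule (M : Type u) [AddCommGroup M] [Module K M]
    [Module R M] [Module Rᵐᵒᵖ M] [SMulCommClass R Rᵐᵒᵖ M] [IsScalarTower K R M]
    [IsScalarTower K Rᵐᵒᵖ M] : Module (Env K R) M :=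
  TensorProduct.Algebra.module

/-- The anti-automorphism `a ⊗ b ↦ b ⊗ a` of the enveloping algebra. -/
noncomputable def envFlip : (Env K R)ᵐᵒᵖ →ₐ[K] Env K R :=
  ((Algebra.TensorProduct.comm K Rᵐᵒᵖ R).toAlgHom.comp
    (Algebra.TensorProduct.map (AlgHom.id K Rᵐᵒᵖ) (AlgEquiv.opOp K R).symm.toAlgHom)).comp
    (Algebra.TensorProduct.opAlgEquiv K K R Rᵐᵒᵖ).symm.toAlgHom

theorem envFlip_op_tmul (a b : R) :
    envFlip K R (op (a ⊗ₜ[K] op b)) = b ⊗ₜ[K] op a := by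
  simp [envFlip]

/-- A bimodule `M` as a right module over the enveloping algebra: `x (a ⊗ b) = b x a`. -/
@[reducible] noncomputable def envRightModule (M : Type u) [AddCommGroup M] [Module K M]
    [Module R M] [Module Rᵐᵒᵖ M] [SMulCommClass R Rᵐᵒᵖ M] [IsScalarTower K R M]
    [IsScalarTower K Rᵐᵒᵖ M] : Module (Env K R)ᵐᵒᵖ M :=
  letI := envLeftModule K R M
  Module.compHom M (envFlip K R).toRingHom

theorem envLeftModule_smul (M : Type u) [AddCommGroup M] [Module K M]
    [Module R M] [Module Rᵐᵒᵖ M] [SMulCommClass R Rᵐᵒᵖ M] [IsScalarTower K R M]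
    [IsScalarTower K Rᵐᵒᵖ M] (a b : R) (x : M) :
    letI := envLeftModule K R M
    (a ⊗ₜ[K] op b : Env K R) • x = a • op b • x :=
  TensorProduct.Algebra.smul_def a (op b) x

theorem envRightModule_smul (M : Type u) [AddCommGroup M] [Module K M]
    [Module R M] [Module Rᵐᵒᵖ M] [SMulCommClass R Rᵐᵒᵖ M] [IsScalarTower K R M]
    [IsScalarTower K Rᵐᵒᵖ M] (a b : R) (x : M) :
    letI := envRightModule K R M
    op (a ⊗ₜ[K] op b : Env K R) • x = b • op a • x := by
  let := envLeftModule K R M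
  show envFlip K R (op (a ⊗ₜ[K] op b)) • x = _
  rw [envFlip_op_tmul, envLeftModule_smul]

theorem envRightModule_isScalarTower (M : Type u) [AddCommGroup M] [Module K M]
    [Module R M] [Module Rᵐᵒᵖ M] [SMulCommClass R Rᵐᵒᵖ M] [IsScalarTower K R M]
    [IsScalarTower K Rᵐᵒᵖ M] :
    letI := envRightModule K R M
    IsScalarTower K (Env K R)ᵐᵒᵖ M := by
  let := envLeftModule K R M
  let := envRightModule K R M
  refine ⟨fun k r x => ?_⟩
  show envFlip K R (k • r) • x = k • (envFlip K R r • x)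
  rw [map_smul]
  generalize envFlip K R r = z
  induction z using TensorProduct.induction_on with
  | zero =>
    have h0 : (0 : Env K R) • x = 0 := zero_smul (Env K R) x
    exact (congrArg (· • x) (smul_zero k)).trans (h0.trans ((smul_zero k).symm.trans
      (congrArg (k • ·) h0.symm)))
  | tmul a b =>
    rw [TensorProduct.smul_tmul', TensorProduct.Algebra.smul_def, TensorProduct.Algebra.smul_def,
      smul_assoc]
  | add y z hy hz => rw [smul_add, add_smul, add_smul, smul_add, hy, hz]

/-- Hochschild homology `H_n(R, M) = Tor_n^{R ⊗ Rᵒᵖ}(R, M)` of a `K`-algebra `R` with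
coefficients in an `R`-bimodule `M`. -/
noncomputable def hochschildHomology (M : Type u) [AddCommGroup M] [Module K M]
    [Module R M] [Module Rᵐᵒᵖ M] [SMulCommClass R Rᵐᵒᵖ M] [IsScalarTower K R M]
    [IsScalarTower K Rᵐᵒᵖ M] (n : ℕ) : ModuleCat.{u} K :=
  letI := envLeftModule K R M
  letI := envRightModule K R R
  haveI := envRightModule_isScalarTower K R R
  algebraTor K (Env K R) R n (ModuleCat.of (Env K R) M)

/-- A (possibly noncommutative) `K`-algebra `R` is separable if `R` is projective as a left
module over its enveloping algebra. -/
def IsSeparableAlgebra : Prop :=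
  letI := envLeftModule K R R
  Module.Projective (Env K R) R

end Hochschild

/-! ## Homology of an inverse monoid -/

section InverseMonoidHomology

variable (K : Type u) [CommRing K] (S : Type u) [InverseMonoid S]

/-- `KE(S)`, the free `K`-module on the idempotents of `S`. -/
abbrev KE : Type u := {e : S // IsIdempotentElem e} →₀ K

variable {S} in
/-- The map `e ↦ s⁻¹ e s` on idempotents. -/
def conjIdem (s : S) (e : {e : S // IsIdempotentElem e}) : {e : S // IsIdempotentElem e} :=
  ⟨s⁻¹ * e * s, conj_idem s e.2⟩

/-- The right action of `S` on `KE(S)`, `e · s = s⁻¹ e s`. -/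
noncomputable def conjRep : S →* (Module.End K (KE K S))ᵐᵒᵖ where
  toFun s := op (Finsupp.lmapDomain K K (conjIdem s))
  map_one' := by
    apply unop_injective
    refine Finsupp.lhom_ext fun e k => ?_
    simp [conjIdem, one_inv]
  map_mul' s t := by
    apply unop_injective
    refine Finsupp.lhom_ext fun e k => ?_
    simp [conjIdem, mul_inv_rev', mul_assoc]

/-- `KE(S)` as a right `KS`-module. -/
noncomputable instance : Module (MonoidAlgebra K S)ᵐᵒᵖ (KE K S) :=
  Module.compHom (KE K S)
    (AlgHom.opComm (MonoidAlgebra.lift K (Module.End K (KE K S))ᵐᵒᵖ S (conjRep K S))).toRingHom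

theorem KE_op_single_smul (s : S) (e : {e : S // IsIdempotentElem e}) (k l : K) :
    (op (MonoidAlgebra.single s k) : (MonoidAlgebra K S)ᵐᵒᵖ) • (Finsupp.single e l : KE K S) =
      Finsupp.single (conjIdem s e) (k * l) := by
  show (AlgHom.opComm (MonoidAlgebra.lift K (Module.End K (KE K S))ᵐᵒᵖ S (conjRep K S)))
    (op (MonoidAlgebra.single s k)) (Finsupp.single e l) = _
  simp [AlgHom.opComm, conjRep, MonoidAlgebra.lift_single]

instance : IsScalarTower K (MonoidAlgebra K S)ᵐᵒᵖ (KE K S) :=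
  ⟨fun k r x => by
    show (AlgHom.opComm (MonoidAlgebra.lift K (Module.End K (KE K S))ᵐᵒᵖ S (conjRep K S)))
      (k • r) x = k • (AlgHom.opComm
        (MonoidAlgebra.lift K (Module.End K (KE K S))ᵐᵒᵖ S (conjRep K S))) r x
    rw [map_smul]; rfl⟩

/-- The homology `H_n(S, V) = Tor_n^{KS}(KE(S), V)` of an inverse monoid `S` with values in a
left `KS`-module `V`. -/
noncomputable def inverseMonoidHomology (V : ModuleCat.{u} (MonoidAlgebra K S)) (n : ℕ) :
    ModuleCat.{u} K :=
  algebraTor K (MonoidAlgebra K S) (KE K S) n V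

end InverseMonoidHomology

/-! ## Unital actions and crossed products -/

/-- A unital action of an inverse monoid `S` on a `K`-algebra `A`: a homomorphism `θ` from `S` to
the monoid of partial bijections of `A` with `θ 1 = id`, such that `ran θ_s = 1_s A` for a central
idempotent `1_s`, and `θ_s` is an algebra isomorphism from its domain onto its range. (The domain
of `θ_s` is then the ideal `1_{s⁻¹} A`; see `UnitalAction.mem_dom`.) -/
structure UnitalAction (K S A : Type u) [CommRing K] [InverseMonoid S] [Ring A] [Algebra K A] where
  θ : S → (A ≃. A)
  θ_one : θ 1 = PEquiv.refl A
  θ_mul : ∀ s t, θ (s * t) = (θ t).trans (θ s)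
  /-- The central idempotent `1_s`. -/
  unit : S → A
  unit_idem : ∀ s, IsIdempotentElem (unit s)
  unit_central : ∀ s a, unit s * a = a * unit s
  mem_ran : ∀ s b, (∃ a, b ∈ θ s a) ↔ ∃ a, b = unit s * a
  θ_add : ∀ s a b a' b', a' ∈ θ s a → b' ∈ θ s b → a' + b' ∈ θ s (a + b)
  θ_mul_mem : ∀ s a b a' b', a' ∈ θ s a → b' ∈ θ s b → a' * b' ∈ θ s (a * b)
  θ_smul : ∀ s (k : K) a a', a' ∈ θ s a → k • a' ∈ θ s (k • a)

namespace UnitalAction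

variable {K S A : Type u} [CommRing K] [InverseMonoid S] [Ring A] [Algebra K A]
variable (T : UnitalAction K S A)

theorem unit_mul_unit (s : S) : T.unit s * T.unit s = T.unit s := T.unit_idem s

theorem mem_inv_of_mem {s : S} {a b : A} (h : b ∈ T.θ s a) : a ∈ T.θ s⁻¹ b := by
  have e : T.θ (s * s⁻¹ * s) = T.θ s := by rw [mul_inv_mul]
  have h' := h
  rw [← e, T.θ_mul, PEquiv.mem_trans] at h'
  obtain ⟨b', hb', hb⟩ := h'
  obtain rfl : b' = b := Option.mem_unique hb' h
  rw [T.θ_mul, PEquiv.mem_trans] at hb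
  obtain ⟨c, hc, hc'⟩ := hb
  rwa [(T.θ s).inj h hc']

theorem mem_inv {s : S} {a b : A} : a ∈ T.θ s⁻¹ b ↔ b ∈ T.θ s a :=
  ⟨fun h => by simpa [inv_inv'] using T.mem_inv_of_mem h, T.mem_inv_of_mem⟩

theorem ran_iff {s : S} {b : A} : (∃ a, b ∈ T.θ s a) ↔ T.unit s * b = b := by
  rw [T.mem_ran]
  constructor
  · rintro ⟨a, rfl⟩
    rw [← mul_assoc, T.unit_mul_unit]
  · intro h
    exact ⟨b, h.symm⟩

theorem mem_dom {s : S} {a : A} : (∃ b, b ∈ T.θ s a) ↔ T.unit s⁻¹ * a = a := by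
  rw [← T.ran_iff]
  simp only [T.mem_inv]

/-- The total map `s · a = θ_s (1_{s⁻¹} a)` on `A`. -/
def act (s : S) (a : A) : A := (T.θ s (T.unit s⁻¹ * a)).getD 0

theorem act_mem (s : S) (a : A) : T.act s a ∈ T.θ s (T.unit s⁻¹ * a) := by
  obtain ⟨b, hb⟩ := T.mem_dom.2 (show T.unit s⁻¹ * (T.unit s⁻¹ * a) = T.unit s⁻¹ * a by
    rw [← mul_assoc, T.unit_mul_unit])
  have hb' : T.θ s (T.unit s⁻¹ * a) = some b := hb
  rw [act, hb']
  rfl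

theorem act_eq {s : S} {a b : A} (h : b ∈ T.θ s (T.unit s⁻¹ * a)) : T.act s a = b :=
  Option.mem_unique (T.act_mem s a) h

theorem act_add (s : S) (a b : A) : T.act s (a + b) = T.act s a + T.act s b := by
  apply T.act_eq
  rw [mul_add]
  exact T.θ_add _ _ _ _ _ (T.act_mem s a) (T.act_mem s b)

theorem act_smul (s : S) (k : K) (a : A) : T.act s (k • a) = k • T.act s a := by
  apply T.act_eq
  rw [mul_smul_comm]
  exact T.θ_smul _ _ _ _ (T.act_mem s a)

theorem act_mul (s : S) (a b : A) : T.act s (a * b) = T.act s a * T.act s b := by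
  apply T.act_eq
  have : T.unit s⁻¹ * (a * b) = T.unit s⁻¹ * a * (T.unit s⁻¹ * b) := by
    conv_lhs => rw [← T.unit_mul_unit s⁻¹]
    rw [mul_assoc, ← mul_assoc _ a b, T.unit_central s⁻¹ a, mul_assoc, ← mul_assoc]
    rw [T.unit_central s⁻¹ a]
  rw [this]
  exact T.θ_mul_mem _ _ _ _ _ (T.act_mem s a) (T.act_mem s b)

theorem unit_mul_act (s : S) (a : A) : T.unit s * T.act s a = T.act s a :=
  T.ran_iff.1 ⟨_, T.act_mem s a⟩

theorem act_unit_inv_mul (s : S) (a : A) : T.act s (T.unit s⁻¹ * a) = T.act s a := by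
  apply T.act_eq
  rw [← mul_assoc, T.unit_mul_unit]
  exact T.act_mem s a

theorem act_inv_act (s : S) (a : A) : T.act s⁻¹ (T.act s a) = T.unit s⁻¹ * a := by
  apply T.act_eq
  rw [inv_inv', T.unit_mul_act]
  exact T.mem_inv.2 (T.act_mem s a)

theorem act_one_right (s : S) : T.act s 1 = T.unit s := by
  have h := T.act_inv_act s⁻¹ 1
  rw [inv_inv', mul_one] at h
  have h2 : T.act s (T.act s⁻¹ 1 * 1) = T.act s (T.act s⁻¹ 1) * T.act s 1 := T.act_mul _ _ _
  rw [mul_one, h, T.unit_mul_act] at h2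
  exact h2.symm

theorem unit_one : T.unit 1 = 1 := by
  have : T.unit 1 * 1 = 1 := T.ran_iff.1 ⟨1, by rw [T.θ_one]; rfl⟩
  rwa [mul_one] at this

theorem act_one (a : A) : T.act 1 a = a := by
  apply T.act_eq
  rw [one_inv, T.unit_one, one_mul, T.θ_one]
  rfl

theorem act_act (s t : S) (a : A) : T.act s (T.act t a) = T.act (s * t) a := by
  set r := s * t with hr
  set c := T.act t a
  have hc : c ∈ T.θ t (T.unit t⁻¹ * a) := T.act_mem t a
  -- `u = 1_{r⁻¹}` lies in the domain of `θ_r`, hence of `θ_t`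
  obtain ⟨y, hy⟩ := (T.mem_dom (s := r)).2 (T.unit_mul_unit r⁻¹)
  rw [hr, T.θ_mul, PEquiv.mem_trans] at hy
  obtain ⟨v, hv, hvy⟩ := hy
  rw [← hr] at hv
  have hv1 : T.unit s⁻¹ * v = v := T.mem_dom.1 ⟨y, hvy⟩
  have hv2 : T.unit t * v = v := T.ran_iff.1 ⟨_, hv⟩
  have hu : T.unit t⁻¹ * T.unit r⁻¹ = T.unit r⁻¹ := T.mem_dom.1 ⟨v, hv⟩
  -- `v = θ_t(u) = 1_{s⁻¹} 1_t`
  have hx : T.unit t * (T.unit s⁻¹ * T.unit t) = T.unit s⁻¹ * T.unit t := by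
    rw [T.unit_central t, mul_assoc, T.unit_mul_unit]
  obtain ⟨w, hw⟩ := T.ran_iff.2 hx
  have hxs : T.unit s⁻¹ * (T.unit s⁻¹ * T.unit t) = T.unit s⁻¹ * T.unit t := by
    rw [← mul_assoc, T.unit_mul_unit]
  obtain ⟨z, hz⟩ := T.mem_dom.2 hxs
  have hwr : T.unit r⁻¹ * w = w := T.mem_dom.1 ⟨z, by
    rw [hr, T.θ_mul, PEquiv.mem_trans]; exact ⟨_, hw, hz⟩⟩
  have h1 := T.θ_mul_mem _ _ _ _ _ hv hw
  rw [hwr] at h1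
  have h2 : v * (T.unit s⁻¹ * T.unit t) = T.unit s⁻¹ * T.unit t := Option.mem_unique h1 hw
  have h3 : v * (T.unit s⁻¹ * T.unit t) = v := by
    rw [← mul_assoc, ← T.unit_central s⁻¹ v, hv1, ← T.unit_central t v, hv2]
  have hvc : v * c = T.unit s⁻¹ * c := by
    rw [← h3, h2, mul_assoc, T.unit_mul_act]
  have h4 := T.θ_mul_mem _ _ _ _ _ hv hc
  rw [← mul_assoc, ← T.unit_central t⁻¹, hu, hvc] at h4
  refine (T.act_eq ?_).symm
  rw [hr, T.θ_mul, PEquiv.mem_trans]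
  rw [← hr]
  exact ⟨_, h4, T.act_mem s c⟩

/-- `act` as a linear map. -/
def actₗ (s : S) : A →ₗ[K] A where
  toFun := T.act s
  map_add' := T.act_add s
  map_smul' := T.act_smul s

@[simp] theorem actₗ_apply (s : S) (a : A) : T.actₗ s a = T.act s a := rfl

/-- The product `a δ_s · b δ_t = a θ_s(1_{s⁻¹} b) δ_{st}`, extended bilinearly to finitely
supported functions `S → A`. -/
noncomputable def mulAux : (S →₀ A) →ₗ[K] (S →₀ A) →ₗ[K] (S →₀ A) :=
  Finsupp.lsum K fun s => LinearMap.flip <| Finsupp.lsum K fun t =>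
    LinearMap.flip ((LinearMap.mul K A).compl₂ (T.actₗ s) |>.compr₂ (Finsupp.lsingle (s * t)))

@[simp] theorem mulAux_single (s t : S) (a b : A) :
    T.mulAux (Finsupp.single s a) (Finsupp.single t b) =
      Finsupp.single (s * t) (a * T.act s b) := by
  simp [mulAux]

theorem mulAux_assoc (f g h : S →₀ A) :
    T.mulAux (T.mulAux f g) h = T.mulAux f (T.mulAux g h) := by
  induction f using Finsupp.induction_linear with
  | zero => simp
  | add f f' hf hf' => simp only [map_add, LinearMap.add_apply, hf, hf']
  | single s a =>
    induction g using Finsupp.induction_linear with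
    | zero => simp
    | add g g' hg hg' => simp only [map_add, LinearMap.add_apply, hg, hg']
    | single t b =>
      induction h using Finsupp.induction_linear with
      | zero => simp
      | add h h' hh hh' => simp only [map_add, hh, hh']
      | single r c => simp only [mulAux_single, mul_assoc, T.act_mul, T.act_act]

/-- `⊕_s 1_s A`, as the finitely supported functions `f : S → A` with `f s ∈ 1_s A`. -/
def skewSubmodule : Submodule K (S →₀ A) where
  carrier := {f | ∀ s, T.unit s * f s = f s}
  zero_mem' s := by simp
  add_mem' hf hg s := by simp [mul_add, hf s, hg s]
  smul_mem' k f hf s := by simp [hf s]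

theorem mem_skewSubmodule {f : S →₀ A} : f ∈ T.skewSubmodule ↔ ∀ s, T.unit s * f s = f s :=
  Iff.rfl

theorem single_mem {s : S} {a : A} (h : T.unit s * a = a) :
    Finsupp.single s a ∈ T.skewSubmodule := by
  classical
  intro t
  by_cases hst : s = t
  · subst hst; simpa using h
  · simp [hst]

theorem skew_induction {p : (S →₀ A) → Prop} (h0 : p 0) (ha : ∀ f g, p f → p g → p (f + g))
    (hs : ∀ s a, T.unit s * a = a → p (Finsupp.single s a)) {f : S →₀ A}
    (hf : f ∈ T.skewSubmodule) : p f := by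
  classical
  have : f = ∑ s ∈ f.support, Finsupp.single s (f s) := (Finsupp.sum_single f).symm
  rw [this]
  exact Finset.sum_induction _ p ha h0 fun s _ => hs s _ (hf s)

theorem mulAux_mem {f g : S →₀ A} (hf : f ∈ T.skewSubmodule) (hg : g ∈ T.skewSubmodule) :
    T.mulAux f g ∈ T.skewSubmodule := by
  refine T.skew_induction (p := fun f => T.mulAux f g ∈ T.skewSubmodule) ?_ ?_ ?_ hf
  · simp
  · intro f f' h h'
    rw [map_add, LinearMap.add_apply]
    exact T.skewSubmodule.add_mem h h'
  · intro s a has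
    refine T.skew_induction (p := fun g => T.mulAux (Finsupp.single s a) g ∈ T.skewSubmodule)
      ?_ ?_ ?_ hg
    · simp
    · intro f f' h h'
      rw [map_add]
      exact T.skewSubmodule.add_mem h h'
    · intro t b hbt
      rw [mulAux_single]
      apply T.single_mem
      -- `a θ_s(1_{s⁻¹} b)` lies in `1_{st} A`
      have hb : T.act s b = T.act (s * t) (T.act t⁻¹ b) := by
        have := T.act_inv_act t⁻¹ b
        rw [inv_inv', hbt] at this
        rw [← T.act_act, this]
      rw [hb, ← mul_assoc, T.unit_central _ a, mul_assoc, T.unit_mul_act]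

/-- The algebra `L(A, θ, S) = ⊕_s 1_s A δ_s`. -/
def SkewAlgebra : Type u := T.skewSubmodule

noncomputable instance : AddCommGroup T.SkewAlgebra :=
  inferInstanceAs (AddCommGroup T.skewSubmodule)

noncomputable instance : Module K T.SkewAlgebra :=
  inferInstanceAs (Module K T.skewSubmodule)

noncomputable instance : Mul T.SkewAlgebra :=
  ⟨fun f g => ⟨T.mulAux f.1 g.1, T.mulAux_mem f.2 g.2⟩⟩

noncomputable instance : One T.SkewAlgebra :=
  ⟨⟨Finsupp.single 1 1, T.single_mem (by rw [T.unit_one, mul_one])⟩⟩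

noncomputable instance : Ring T.SkewAlgebra :=
  { (inferInstance : AddCommGroup T.SkewAlgebra) with
    mul := (· * ·)
    one := 1
    left_distrib := fun f g h => Subtype.ext (map_add (T.mulAux f.1) g.1 h.1)
    right_distrib := fun f g h => Subtype.ext (T.mulAux.map_add₂ f.1 g.1 h.1)
    zero_mul := fun f => Subtype.ext (T.mulAux.map_zero₂ f.1)
    mul_zero := fun f => Subtype.ext (map_zero (T.mulAux f.1))
    mul_assoc := fun f g h => Subtype.ext (T.mulAux_assoc f.1 g.1 h.1)
    one_mul := fun f => Subtype.ext <| by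
      show T.mulAux (Finsupp.single 1 1) f.1 = f.1
      refine T.skew_induction (p := fun g => T.mulAux (Finsupp.single 1 1) g = g) ?_ ?_ ?_ f.2
      · simp
      · intro g h hg hh
        rw [map_add, hg, hh]
      · intro s a _
        rw [mulAux_single, one_mul, one_mul, T.act_one]
    mul_one := fun f => Subtype.ext <| by
      show T.mulAux f.1 (Finsupp.single 1 1) = f.1
      refine T.skew_induction (p := fun g => T.mulAux g (Finsupp.single 1 1) = g) ?_ ?_ ?_ f.2
      · simp
      · intro g h hg hh
        rw [map_add, LinearMap.add_apply, hg, hh]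
      · intro s a has
        rw [mulAux_single, mul_one, T.act_one_right, ← T.unit_central, has]
    zsmul := (· • ·)
    nsmul := (· • ·)
    zsmul_zero' := fun a => zero_smul ℤ a
    zsmul_succ' := fun n a => SubNegMonoid.zsmul_succ' n a
    zsmul_neg' := fun n a => SubNegMonoid.zsmul_neg' n a
    nsmul_zero := fun a => zero_smul ℕ a
    nsmul_succ := fun n a => succ_nsmul a n }

noncomputable instance : Algebra K T.SkewAlgebra :=
  Algebra.ofModule
    (fun k f g => Subtype.ext (T.mulAux.map_smul₂ k f.1 g.1))
    (fun k f g => Subtype.ext (map_smul (T.mulAux f.1) k g.1))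

/-- The element `(1_s a) δ_s` of `L(A, θ, S)`; it is `a δ_s` when `a ∈ 1_s A`. -/
noncomputable def delta (s : S) (a : A) : T.SkewAlgebra :=
  ⟨Finsupp.single s (T.unit s * a), T.single_mem (by rw [← mul_assoc, T.unit_mul_unit])⟩

theorem delta_mul_delta (s t : S) (a b : A) (ha : T.unit s * a = a) (hb : T.unit t * b = b) :
    T.delta s a * T.delta t b = T.delta (s * t) (a * T.act s b) := by
  have h := T.mulAux_mem (T.single_mem ha) (T.single_mem hb) (s * t)
  rw [mulAux_single, Finsupp.single_eq_same] at h
  apply Subtype.ext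
  show T.mulAux (Finsupp.single s (T.unit s * a)) (Finsupp.single t (T.unit t * b)) =
    Finsupp.single (s * t) (T.unit (s * t) * (a * T.act s b))
  rw [ha, hb, mulAux_single, h]

/-- The ideal of `L(A, θ, S)` generated by `a δ_s - a δ_t` for `s ≤ t` and `a ∈ 1_s A`
(in which case `a ∈ 1_t A` too). -/
noncomputable def orderIdeal : TwoSidedIdeal T.SkewAlgebra :=
  TwoSidedIdeal.span
    {z | ∃ (s t : S) (a : A), NatLE s t ∧ T.unit s * a = a ∧ z = T.delta s a - T.delta t a}

theorem unit_mul_of_natLE {s t : S} (h : NatLE s t) {a : A} (ha : T.unit s * a = a) :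
    T.unit t * a = a := by
  obtain ⟨e, he, rfl⟩ := h
  -- the range of `θ_{et}` is contained in the range of `θ_t`
  have he' : T.θ e = (T.θ e).trans (T.θ e) := by rw [← T.θ_mul, he]
  obtain ⟨x, hx⟩ := T.ran_iff.2 ha
  rw [T.θ_mul, PEquiv.mem_trans] at hx
  obtain ⟨y, hy, hya⟩ := hx
  have hya' := hya
  rw [he', PEquiv.mem_trans] at hya'
  obtain ⟨z, hz, hza⟩ := hya'
  obtain rfl : z = a := Option.mem_unique hz hya
  obtain rfl : z = y := (T.θ e).inj hza hya
  exact T.ran_iff.1 ⟨x, hy⟩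

/-- The crossed product `A ⋊_θ S`. -/
def CrossedProduct : Type u := T.orderIdeal.ringCon.Quotient

noncomputable instance : Ring T.CrossedProduct :=
  inferInstanceAs (Ring T.orderIdeal.ringCon.Quotient)

noncomputable instance : Algebra K T.CrossedProduct :=
  inferInstanceAs (Algebra K T.orderIdeal.ringCon.Quotient)

/-- The quotient map `L(A, θ, S) → A ⋊_θ S`. -/
noncomputable def toCrossed : T.SkewAlgebra →+* T.CrossedProduct := T.orderIdeal.ringCon.mk'

/-- The homomorphism `A → A ⋊_θ S`, `a ↦ a δ_1 + 𝒩`. -/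
noncomputable def ofBase (a : A) : T.CrossedProduct := T.toCrossed (T.delta 1 a)

/-- The monoid homomorphism `S → A ⋊_θ S`, `s ↦ 1_s δ_s + 𝒩`. -/
noncomputable def ofMonoid : S →* T.CrossedProduct where
  toFun s := T.toCrossed (T.delta s (T.unit s))
  map_one' := by
    rw [← map_one T.toCrossed]
    congr 1
    apply Subtype.ext
    show Finsupp.single 1 _ = Finsupp.single 1 _
    rw [T.unit_mul_unit, T.unit_one]
  map_mul' s t := by
    rw [← map_mul, T.delta_mul_delta _ _ _ _ (T.unit_mul_unit s) (T.unit_mul_unit t),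
      T.unit_mul_act]
    congr 2
    rw [← T.act_one_right t, T.act_act, T.act_one_right]

theorem ofMonoid_mul_ofBase (s : S) (a : A) :
    T.ofMonoid s * T.ofBase a = T.ofBase (T.act s a) * T.ofMonoid s := by
  show T.toCrossed _ * T.toCrossed _ = T.toCrossed _ * T.toCrossed _
  rw [← map_mul, ← map_mul,
    T.delta_mul_delta _ _ _ _ (T.unit_mul_unit s) (by rw [T.unit_one, one_mul]),
    T.delta_mul_delta _ _ _ _ (by rw [T.unit_one, one_mul]) (T.unit_mul_unit s),
    T.unit_mul_act, mul_one, one_mul, T.act_one, ← T.unit_central, T.unit_mul_act]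

theorem ofBase_mul_ofMonoid_inv (s : S) (a : A) :
    T.ofBase a * T.ofMonoid s⁻¹ = T.ofMonoid s⁻¹ * T.ofBase (T.act s a) := by
  rw [T.ofMonoid_mul_ofBase, T.act_inv_act]
  show T.toCrossed _ * T.toCrossed _ = T.toCrossed _ * T.toCrossed _
  rw [← map_mul, ← map_mul,
    T.delta_mul_delta _ _ _ _ (by rw [T.unit_one, one_mul]) (T.unit_mul_unit _),
    T.delta_mul_delta _ _ _ _ (by rw [T.unit_one, one_mul]) (T.unit_mul_unit _),
    T.act_one, T.unit_central, mul_assoc, T.unit_mul_unit]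

section Bimodule

variable (M : Type u) [AddCommGroup M] [Module K M] [Module T.CrossedProduct M]
  [Module T.CrossedProductᵐᵒᵖ M] [SMulCommClass T.CrossedProduct T.CrossedProductᵐᵒᵖ M]
  [IsScalarTower K T.CrossedProduct M] [IsScalarTower K T.CrossedProductᵐᵒᵖ M]

/-- The left action `s · x = (1_s δ_s) x (1_{s⁻¹} δ_{s⁻¹})` of `S` on an
`A ⋊_θ S`-bimodule `M`. -/
noncomputable def bimoduleRep : Representation K S M where
  toFun s :=
    Module.toModuleEnd K (S := T.CrossedProduct) M (T.ofMonoid s) *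
      Module.toModuleEnd K (S := T.CrossedProductᵐᵒᵖ) M (op (T.ofMonoid s⁻¹))
  map_one' := by
    ext x
    simp [one_inv]
  map_mul' s t := by
    ext x
    simp only [Module.End.mul_apply, Module.toModuleEnd_apply, DistribSMul.toLinearMap_apply,
      mul_inv_rev', map_mul, op_mul]
    rw [smul_comm (T.ofMonoid t) (op (T.ofMonoid s⁻¹))]

theorem bimoduleRep_apply (s : S) (x : M) :
    T.bimoduleRep M s x = T.ofMonoid s • op (T.ofMonoid s⁻¹) • x := rfl

/-- The `K`-submodule `[A, M]` generated by the elements `a x - x a`. -/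
def commutators : Submodule K M :=
  Submodule.span K {z | ∃ (a : A) (x : M), z = T.ofBase a • x - op (T.ofBase a) • x}

theorem commutators_le_comap (s : S) :
    T.commutators M ≤ (T.commutators M).comap (T.bimoduleRep M s) := by
  refine Submodule.span_le.2 ?_
  rintro _ ⟨a, x, rfl⟩
  refine Submodule.subset_span ⟨T.act s a, T.bimoduleRep M s x, ?_⟩
  rw [map_sub]
  simp only [bimoduleRep_apply]
  congr 1
  · rw [← smul_comm (T.ofBase a), ← mul_smul, ← mul_smul, T.ofMonoid_mul_ofBase]
  · rw [← smul_comm (T.ofMonoid s) (op (T.ofBase (T.act s a))), ← mul_smul (op _) (op _),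
      ← mul_smul (op _) (op _), ← op_mul, ← op_mul, T.ofBase_mul_ofMonoid_inv]

/-- The left `KS`-module `M / [A, M]`. -/
noncomputable def coinvariants : ModuleCat.{u} (MonoidAlgebra K S) :=
  ModuleCat.of (MonoidAlgebra K S)
    ((T.bimoduleRep M).quotient (T.commutators M) (T.commutators_le_comap M)).asModule

end Bimodule

end UnitalAction

set_option linter.unusedSectionVars false

/-! ## Exactness properties of the balanced tensor product -/

/-! Write `B` for the crossed product and `B^e` for its enveloping algebra. The two homologies are
compared through the functor `F(Y) = Y / [A, Y]` from `B^e`-modules to `KS`-modules, where `s` acts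
as `δ_s ⊗ δ_{s⁻¹}`. Three facts about `F` suffice.

`F` is exact. Separability of `A` gives `p ∈ A^e` with `μ(p) = 1` and `(a ⊗ 1) p = (1 ⊗ a) p`. Its
image `ε ∈ B^e`, with tensor factors exchanged, satisfies `[A, Y] = ker ε` and `y ≡ ε y` modulo `[A,
Y]`, for all `Y` at once (`exists_mem_commSubgroup_iff`, `coinvFunctor_preservesHomology`).

`F` turns tensor products over `KS` into tensor products over `B^e`: for each right `KS`-module `X`,
`X ⊗_{KS} F(Y) ≅ (X ⊗_{KE(S)} B) ⊗_{B^e} Y`, where `B` acts on the left through the second factor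
and on the right diagonally, `(x ⊗ b) · a δ_t = x t ⊗ b a δ_t` (`tensorCoinv_bijective`). For `X =
KE(S)` the bimodule is `B` itself, so `KE(S) ⊗_{KS} F(-) ≅ B ⊗_{B^e} -` (`coinvTensorIso`).

`F` sends projective modules to flat ones. The algebra `KE(S)` is commutative and spanned by
idempotents over a field, so all its modules are flat (`Idem.flat`). Hence `X ↦ X ⊗_{KE(S)} B`
preserves injections, and the isomorphism above carries flatness from `Y` to `F(Y)`
(`isTensorFlat_coinvFunctor_obj`).

If `Q` is a projective resolution of `M`, then `F(Q)` is a resolution of `F(M)` by flat, not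
necessarily projective, modules. It still computes Tor: a projective resolution of `F(M)` maps to it
by a quasi-isomorphism, which survives tensoring (`isIso_homologyMap_balancedTensor`). So
`Tor^{KS}(KE(S), F(M))` is the homology of `KE(S) ⊗_{KS} F(Q) ≅ B ⊗_{B^e} Q`, which is Hochschild
homology. -/

theorem Submodule.exact_mapQ {K A B C : Type*} [Ring K] [AddCommGroup A] [AddCommGroup B]
    [AddCommGroup C] [Module K A] [Module K B] [Module K C] {f : A →ₗ[K] B} {g : B →ₗ[K] C}
    (h : Function.Exact f g) {p : Submodule K A} {q : Submodule K B} {r : Submodule K C}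
    (hf : p ≤ q.comap f) (hg : q ≤ r.comap g) (hr : r ≤ q.map g) :
    Function.Exact (p.mapQ q f hf) (q.mapQ r g hg) := by
  intro b
  obtain ⟨b, rfl⟩ := Submodule.Quotient.mk_surjective _ b
  constructor
  · intro hb
    rw [Submodule.mapQ_apply, Submodule.Quotient.mk_eq_zero] at hb
    -- Every relation in the target lifts to a relation `b'`; subtracting it moves `b` into the
    -- honest kernel of `g` without changing its class.
    obtain ⟨b', hb', e⟩ := hr hb
    obtain ⟨a, ha⟩ := (h (b - b')).1 (by rw [map_sub, e, sub_self])
    refine ⟨Submodule.Quotient.mk a, ?_⟩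
    rw [Submodule.mapQ_apply, ha, Submodule.Quotient.mk_sub,
      (Submodule.Quotient.mk_eq_zero q).2 hb', sub_zero]
  · rintro ⟨a, ha⟩
    obtain ⟨a, rfl⟩ := Submodule.Quotient.mk_surjective _ a
    rw [← ha, Submodule.mapQ_apply, Submodule.mapQ_apply, h.apply_apply_eq_zero,
      Submodule.Quotient.mk_zero]

namespace BalancedTensor

section

variable (K : Type u) [CommRing K] (R : Type u) [Ring R]
variable {X Y : Type u} [AddCommGroup X] [Module K X] [Module Rᵐᵒᵖ X]
  [AddCommGroup Y] [Module K Y] [Module R Y]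

/-- The class of `x ⊗ y` in `X ⊗_R Y`, as a bilinear map. -/
noncomputable def mkₗ : X →ₗ[K] Y →ₗ[K] BalancedTensor K R X Y :=
  (TensorProduct.mk K X Y).compr₂ (balancedRelations K R X Y).mkQ

/-- The class of `x ⊗ y` in `X ⊗_R Y`. -/
noncomputable def mk (x : X) (y : Y) : BalancedTensor K R X Y := mkₗ K R x y

theorem mkₗ_apply (x : X) (y : Y) : mkₗ K R x y = mk K R x y := rfl

theorem mk_add_left (x x' : X) (y : Y) : mk K R (x + x') y = mk K R x y + mk K R x' y :=
  (mkₗ K R).map_add₂ x x' y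

theorem mk_add_right (x : X) (y y' : Y) : mk K R x (y + y') = mk K R x y + mk K R x y' :=
  map_add (mkₗ K R x) y y'

theorem mk_zero_left (y : Y) : mk K R (0 : X) y = 0 := (mkₗ K R).map_zero₂ y

theorem mk_zero_right (x : X) : mk K R x (0 : Y) = 0 := map_zero (mkₗ K R x)

theorem mk_smul_left (k : K) (x : X) (y : Y) : mk K R (k • x) y = k • mk K R x y :=
  (mkₗ K R).map_smul₂ k x y

theorem mk_smul_right (k : K) (x : X) (y : Y) : mk K R x (k • y) = k • mk K R x y :=
  map_smul (mkₗ K R x) k y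

theorem mk_smul (x : X) (r : R) (y : Y) : mk K R (op r • x) y = mk K R x (r • y) := by
  refine (Submodule.Quotient.eq _).2 (Submodule.subset_span ⟨x, r, y, rfl⟩)

variable {K R} in
theorem hom_ext {V : Type*} [AddCommGroup V] [Module K V] {f g : BalancedTensor K R X Y →ₗ[K] V}
    (h : ∀ x y, f (mk K R x y) = g (mk K R x y)) : f = g :=
  Submodule.linearMap_qext _ (TensorProduct.ext' h)

variable {K R} in
theorem induction {p : BalancedTensor K R X Y → Prop} (h0 : p 0) (hm : ∀ x y, p (mk K R x y))
    (ha : ∀ z w, p z → p w → p (z + w)) (z : BalancedTensor K R X Y) : p z := by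
  obtain ⟨z, rfl⟩ := Submodule.Quotient.mk_surjective _ z
  induction z using TensorProduct.induction_on with
  | zero => exact h0
  | tmul x y => exact hm x y
  | add z w hz hw => exact ha _ _ hz hw

/-- The universal property of `X ⊗_R Y`. -/
noncomputable def lift {V : Type*} [AddCommGroup V] [Module K V] (f : X →ₗ[K] Y →ₗ[K] V)
    (h : ∀ x (r : R) y, f (op r • x) y = f x (r • y)) : BalancedTensor K R X Y →ₗ[K] V :=
  Submodule.liftQ _ (TensorProduct.lift f) <| by
    refine Submodule.span_le.2 ?_
    rintro _ ⟨x, r, y, rfl⟩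
    simp [h]

theorem lift_mk {V : Type*} [AddCommGroup V] [Module K V] (f : X →ₗ[K] Y →ₗ[K] V)
    (h : ∀ x (r : R) y, f (op r • x) y = f x (r • y)) (x : X) (y : Y) :
    lift K R f h (mk K R x y) = f x y :=
  TensorProduct.lift.tmul x y

end

section

variable (K : Type u) [CommRing K] (R : Type u) [Ring R] [Algebra K R]
variable {X X' X'' : Type u} [AddCommGroup X] [Module K X] [Module Rᵐᵒᵖ X]
  [IsScalarTower K Rᵐᵒᵖ X]
  [AddCommGroup X'] [Module K X'] [Module Rᵐᵒᵖ X'] [IsScalarTower K Rᵐᵒᵖ X']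
  [AddCommGroup X''] [Module K X''] [Module Rᵐᵒᵖ X''] [IsScalarTower K Rᵐᵒᵖ X'']
variable {Y Z W : Type u} [AddCommGroup Y] [Module K Y] [Module R Y] [IsScalarTower K R Y]
  [AddCommGroup Z] [Module K Z] [Module R Z] [IsScalarTower K R Z]
  [AddCommGroup W] [Module K W] [Module R W] [IsScalarTower K R W]

/-- The `K`-linear map `f ⊗_R Y : X ⊗_R Y → X' ⊗_R Y` induced by a right `R`-linear map `f`. -/
noncomputable def mapLeft (Y : Type u) [AddCommGroup Y] [Module K Y] [Module R Y]
    (f : X →ₗ[Rᵐᵒᵖ] X') : BalancedTensor K R X Y →ₗ[K] BalancedTensor K R X' Y :=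
  Submodule.mapQ _ _ (LinearMap.rTensor Y (f.restrictScalars K)) <| by
    refine Submodule.span_le.2 ?_
    rintro _ ⟨x, r, y, rfl⟩
    refine Submodule.subset_span ⟨f x, r, y, ?_⟩
    simp [map_sub]

theorem mapLeft_mk (f : X →ₗ[Rᵐᵒᵖ] X') (x : X) (y : Y) :
    mapLeft K R Y f (mk K R x y) = mk K R (f x) y := rfl

theorem map_mk (f : Y →ₗ[R] Z) (x : X) (y : Y) :
    map K R X f (mk K R x y) = mk K R x (f y) := rfl

theorem mapLeft_map (f : X →ₗ[Rᵐᵒᵖ] X') (g : Y →ₗ[R] Z) (z : BalancedTensor K R X Y) :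
    mapLeft K R Z f (map K R X g z) = map K R X' g (mapLeft K R Y f z) :=
  LinearMap.congr_fun (hom_ext (f := mapLeft K R Z f ∘ₗ map K R X g)
    (g := map K R X' g ∘ₗ mapLeft K R Y f) fun _ _ => rfl) z

theorem mapLeft_surjective {f : X →ₗ[Rᵐᵒᵖ] X'} (hf : Function.Surjective f) :
    Function.Surjective (mapLeft K R Y f) := by
  intro z
  induction z using induction with
  | h0 => exact ⟨0, map_zero _⟩
  | hm x y =>
    obtain ⟨x, rfl⟩ := hf x
    exact ⟨mk K R x y, rfl⟩
  | ha z w hz hw =>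
    obtain ⟨z, rfl⟩ := hz
    obtain ⟨w, rfl⟩ := hw
    exact ⟨z + w, map_add _ _ _⟩

theorem map_surjective {f : Y →ₗ[R] Z} (hf : Function.Surjective f) :
    Function.Surjective (map K R X f) := by
  intro z
  induction z using induction with
  | h0 => exact ⟨0, map_zero _⟩
  | hm x y =>
    obtain ⟨y, rfl⟩ := hf y
    exact ⟨mk K R x y, rfl⟩
  | ha z w hz hw =>
    obtain ⟨z, rfl⟩ := hz
    obtain ⟨w, rfl⟩ := hw
    exact ⟨z + w, map_add _ _ _⟩

/-- Right exactness is inherited from the tensor product over `K`. Surjectivity of `g` is used a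
second time to lift the balancing relations, as `Submodule.exact_mapQ` requires. -/
theorem mapLeft_exact {f : X →ₗ[Rᵐᵒᵖ] X'} {g : X' →ₗ[Rᵐᵒᵖ] X''} (h : Function.Exact f g)
    (hg : Function.Surjective g) : Function.Exact (mapLeft K R Y f) (mapLeft K R Y g) := by
  refine Submodule.exact_mapQ
    (rTensor_exact Y (f := f.restrictScalars K) (g := g.restrictScalars K) h hg) _ _ ?_
  refine Submodule.span_le.2 ?_
  rintro _ ⟨x, r, y, rfl⟩
  obtain ⟨x, rfl⟩ := hg x
  exact ⟨_, Submodule.subset_span ⟨x, r, y, rfl⟩, by simp⟩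

theorem map_exact {f : Y →ₗ[R] Z} {g : Z →ₗ[R] W} (h : Function.Exact f g)
    (hg : Function.Surjective g) : Function.Exact (map K R X f) (map K R X g) := by
  refine Submodule.exact_mapQ
    (lTensor_exact X (f := f.restrictScalars K) (g := g.restrictScalars K) h hg) _ _ ?_
  refine Submodule.span_le.2 ?_
  rintro _ ⟨x, r, y, rfl⟩
  obtain ⟨y, rfl⟩ := hg y
  exact ⟨_, Submodule.subset_span ⟨x, r, y, rfl⟩, by simp⟩

variable (Y) in
/-- The isomorphism `R^(ι) ⊗_R Y → Y^(ι)`, for a free right module `R^(ι)`. -/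
noncomputable def freeLeft (ι : Type u) :
    BalancedTensor K R (ι →₀ Rᵐᵒᵖ) Y →ₗ[K] (ι →₀ Y) :=
  lift K R (Finsupp.lsum K fun i =>
      (LinearMap.mk₂ K (fun (r : Rᵐᵒᵖ) (y : Y) => unop r • y)
        (fun r s y => add_smul _ _ _) (fun k r y => smul_assoc _ _ _)
        (fun r y z => smul_add _ _ _) (fun k r y => smul_algebra_smul_comm _ _ _)).compr₂
          (Finsupp.lsingle i)) <| by
    intro x r y
    induction x using Finsupp.induction_linear with
    | zero => simp
    | add f g hf hg => simp only [smul_add, map_add, LinearMap.add_apply, hf, hg]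
    | single i s =>
      rw [Finsupp.smul_single]
      simp [mul_smul, -Finsupp.single_mul]

theorem freeLeft_mk_single {ι : Type u} (i : ι) (r : Rᵐᵒᵖ) (y : Y) :
    freeLeft K R Y ι (mk K R (Finsupp.single i r) y) = Finsupp.single i (unop r • y) := by
  simp [freeLeft, lift_mk]

theorem freeLeft_injective (ι : Type u) : Function.Injective (freeLeft K R Y ι) := by
  -- The would-be inverse sends `y` in position `i` to `e_i ⊗ y`. Injectivity needs only one of the
  -- two inverse identities.
  let g : (ι →₀ Y) →ₗ[K] BalancedTensor K R (ι →₀ Rᵐᵒᵖ) Y :=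
    Finsupp.lsum K fun i => mkₗ K R (Finsupp.single i 1)
  have h : g ∘ₗ freeLeft K R Y ι = LinearMap.id := by
    refine hom_ext fun x y => ?_
    induction x using Finsupp.induction_linear with
    | zero => simp only [mk_zero_left, map_zero]
    | add f f' hf hf' => simp only [mk_add_left, map_add, hf, hf']
    | single i s =>
      simp only [LinearMap.comp_apply, freeLeft_mk_single, LinearMap.id_apply, g,
        Finsupp.lsum_single, mkₗ_apply]
      rw [← mk_smul]
      simp
  exact Function.LeftInverse.injective (g := g) fun z => LinearMap.congr_fun h z

/-- Free right modules are flat. -/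
theorem map_injective_of_free (ι : Type u) {f : Y →ₗ[R] Z} (hf : Function.Injective f) :
    Function.Injective (map K R (ι →₀ Rᵐᵒᵖ) f) := by
  have h : freeLeft K R Z ι ∘ₗ map K R (ι →₀ Rᵐᵒᵖ) f =
      Finsupp.mapRange.linearMap (f.restrictScalars K) ∘ₗ freeLeft K R Y ι := by
    refine hom_ext fun x y => ?_
    induction x using Finsupp.induction_linear with
    | zero => simp only [mk_zero_left, map_zero]
    | add f f' hf hf' => simp only [mk_add_left, map_add, hf, hf']
    | single i s => simp [map_mk, freeLeft_mk_single]
  have h' : Function.Injective (freeLeft K R Z ι ∘ₗ map K R (ι →₀ Rᵐᵒᵖ) f) := by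
    rw [h]
    exact (Finsupp.mapRange_injective f (map_zero f) hf).comp (freeLeft_injective K R ι)
  exact Function.Injective.of_comp h'

variable (X) in
/-- The isomorphism `X ⊗_R R^(ι) → X^(ι)`, for a free left module `R^(ι)`. -/
noncomputable def freeRight (ι : Type u) :
    BalancedTensor K R X (ι →₀ R) →ₗ[K] (ι →₀ X) :=
  lift K R (LinearMap.flip <| Finsupp.lsum K fun i =>
      (LinearMap.mk₂ K (fun (r : R) (x : X) => op r • x)
        (fun r s y => by rw [MulOpposite.op_add, add_smul])
        (fun k r y => by rw [MulOpposite.op_smul, smul_assoc])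
        (fun r y z => smul_add _ _ _) (fun k r y => smul_algebra_smul_comm _ _ _)).compr₂
          (Finsupp.lsingle i)) <| by
    intro x r y
    induction y using Finsupp.induction_linear with
    | zero => simp
    | add f g hf hg => simp only [smul_add, map_add, hf, hg]
    | single i s =>
      rw [Finsupp.smul_single]
      simp [mul_smul, -Finsupp.single_mul]

theorem freeRight_mk_single {ι : Type u} (i : ι) (r : R) (x : X) :
    freeRight K R X ι (mk K R x (Finsupp.single i r)) = Finsupp.single i (op r • x) := by
  simp [freeRight, lift_mk]

theorem freeRight_injective (ι : Type u) : Function.Injective (freeRight K R X ι) := by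
  let g : (ι →₀ X) →ₗ[K] BalancedTensor K R X (ι →₀ R) :=
    Finsupp.lsum K fun i => (mkₗ K R).flip (Finsupp.single i 1)
  have h : g ∘ₗ freeRight K R X ι = LinearMap.id := by
    refine hom_ext fun x y => ?_
    induction y using Finsupp.induction_linear with
    | zero => simp only [mk_zero_right, map_zero]
    | add f f' hf hf' => simp only [mk_add_right, map_add, hf, hf']
    | single i s =>
      simp only [LinearMap.comp_apply, freeRight_mk_single, LinearMap.id_apply, g,
        Finsupp.lsum_single, LinearMap.flip_apply, mkₗ_apply]
      rw [mk_smul]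
      simp
  exact Function.LeftInverse.injective (g := g) fun z => LinearMap.congr_fun h z

/-- Free left modules are flat. -/
theorem mapLeft_injective_of_free (ι : Type u) {f : X →ₗ[Rᵐᵒᵖ] X'} (hf : Function.Injective f) :
    Function.Injective (mapLeft K R (ι →₀ R) f) := by
  have h : freeRight K R X' ι ∘ₗ mapLeft K R (ι →₀ R) f =
      Finsupp.mapRange.linearMap (f.restrictScalars K) ∘ₗ freeRight K R X ι := by
    refine hom_ext fun x y => ?_
    induction y using Finsupp.induction_linear with
    | zero => simp only [mk_zero_right, map_zero]
    | add f f' hf hf' => simp only [mk_add_right, map_add, hf, hf']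
    | single i s => simp [mapLeft_mk, freeRight_mk_single]
  have h' : Function.Injective (freeRight K R X' ι ∘ₗ mapLeft K R (ι →₀ R) f) := by
    rw [h]
    exact (Finsupp.mapRange_injective f (map_zero f) hf).comp (freeRight_injective K R ι)
  exact Function.Injective.of_comp h'

/-- Projective left modules are flat. -/
theorem mapLeft_injective_of_projective [Module.Projective R Y] {f : X →ₗ[Rᵐᵒᵖ] X'}
    (hf : Function.Injective f) : Function.Injective (mapLeft K R Y f) := by
  obtain ⟨s, hs⟩ := Module.projective_def'.1 ‹Module.Projective R Y›
  -- The section `s` exhibits `Y` as a direct summand of the free module on `Y`, so `X ⊗ Y` embeds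
  -- in `X ⊗ R^(Y)` compatibly with maps in `X`, and the free case applies.
  have hi : Function.Injective (map K R X s) := by
    refine Function.LeftInverse.injective
      (g := map K R X (Finsupp.linearCombination R (id : Y → Y))) fun z => ?_
    induction z using induction with
    | h0 => simp only [map_zero]
    | hm x y => rw [map_mk, map_mk, ← LinearMap.comp_apply, hs, LinearMap.id_apply]
    | ha z w hz hw => simp only [map_add, hz, hw]
  have h' : Function.Injective (map K R X' s ∘ mapLeft K R Y f) := by
    have : map K R X' s ∘ mapLeft K R Y f = mapLeft K R _ f ∘ map K R X s :=
      funext fun z => (mapLeft_map K R f s z).symm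
    rw [this]
    exact (mapLeft_injective_of_free K R Y hf).comp hi
  exact Function.Injective.of_comp h'

end

end BalancedTensor

/-! ## Flat modules and quasi-isomorphisms -/

section

variable (K : Type u) [CommRing K] (R : Type u) [Ring R] [Algebra K R]

attribute [local instance] algebraModule algebraModule_isScalarTower

/-- A left `R`-module `Y` is flat if `- ⊗_R Y` preserves injectivity. -/
def IsTensorFlat (Y : ModuleCat.{u} R) : Prop :=
  ∀ (X X' : Type u) [AddCommGroup X] [Module K X] [Module Rᵐᵒᵖ X] [IsScalarTower K Rᵐᵒᵖ X]
    [AddCommGroup X'] [Module K X'] [Module Rᵐᵒᵖ X'] [IsScalarTower K Rᵐᵒᵖ X']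
    (f : X →ₗ[Rᵐᵒᵖ] X'), Function.Injective f →
      Function.Injective (BalancedTensor.mapLeft K R Y f)

theorem isTensorFlat_of_projective (Y : ModuleCat.{u} R) [Projective Y] :
    IsTensorFlat K R Y := by
  intro X X' _ _ _ _ _ _ _ _ f hf
  have : Module.Projective R Y := (IsProjective.iff_projective _).2 inferInstance
  exact BalancedTensor.mapLeft_injective_of_projective K R hf

variable {X X' X'' : Type u} [AddCommGroup X] [Module K X] [Module Rᵐᵒᵖ X]
  [IsScalarTower K Rᵐᵒᵖ X]
  [AddCommGroup X'] [Module K X'] [Module Rᵐᵒᵖ X'] [IsScalarTower K Rᵐᵒᵖ X']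
  [AddCommGroup X''] [Module K X''] [Module Rᵐᵒᵖ X''] [IsScalarTower K Rᵐᵒᵖ X'']

/-- The natural transformation `f ⊗_R -` induced by a map `f` of right modules. -/
noncomputable def balancedTensorFunctorMap (f : X →ₗ[Rᵐᵒᵖ] X') :
    balancedTensorFunctor K R X ⟶ balancedTensorFunctor K R X' where
  app Y := ModuleCat.ofHom (BalancedTensor.mapLeft K R Y f)
  naturality Y Z g := by
    ext : 1
    exact BalancedTensor.hom_ext fun _ _ => rfl

theorem balancedTensorFunctorMap_comp_eq_zero {f : X →ₗ[Rᵐᵒᵖ] X'} {g : X' →ₗ[Rᵐᵒᵖ] X''}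
    (h : g ∘ₗ f = 0) :
    balancedTensorFunctorMap K R f ≫ balancedTensorFunctorMap K R g = 0 := by
  ext Y : 3
  refine BalancedTensor.hom_ext fun x y => ?_
  show BalancedTensor.mk K R ((g ∘ₗ f) x) y = 0
  rw [h]
  exact BalancedTensor.mk_zero_left K R y

/-- The sequence of complexes `X ⊗_R C → X' ⊗_R C → X'' ⊗_R C`. -/
noncomputable abbrev balancedTensorShortComplex {f : X →ₗ[Rᵐᵒᵖ] X'} {g : X' →ₗ[Rᵐᵒᵖ] X''}
    (h : g ∘ₗ f = 0) (C : ChainComplex (ModuleCat.{u} R) ℕ) :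
    ShortComplex (ChainComplex (ModuleCat.{u} K) ℕ) :=
  ShortComplex.mk
    ((NatTrans.mapHomologicalComplex (balancedTensorFunctorMap K R f) _).app C)
    ((NatTrans.mapHomologicalComplex (balancedTensorFunctorMap K R g) _).app C) (by
      ext n : 1
      exact congrArg (fun t => t.app (C.X n)) (balancedTensorFunctorMap_comp_eq_zero K R h))

/-- Exactness is checked degree by degree. Only injectivity on the left needs the flatness of the
terms of `C`; the rest is right exactness. -/
theorem balancedTensorShortComplex_shortExact {f : X →ₗ[Rᵐᵒᵖ] X'} {g : X' →ₗ[Rᵐᵒᵖ] X''}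
    (h : g ∘ₗ f = 0) (hf : Function.Injective f) (hfg : Function.Exact f g)
    (hg : Function.Surjective g)
    (C : ChainComplex (ModuleCat.{u} R) ℕ) (hC : ∀ n, IsTensorFlat K R (C.X n)) :
    (balancedTensorShortComplex K R h C).ShortExact := by
  refine HomologicalComplex.shortExact_of_degreewise_shortExact _ fun n => ?_
  refine ShortComplex.ShortExact.mk' ?_ ?_ ?_
  · rw [ShortComplex.ShortExact.moduleCat_exact_iff_function_exact]
    exact BalancedTensor.mapLeft_exact K R (Y := C.X n) hfg hg
  · rw [ModuleCat.mono_iff_injective]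
    exact hC n X X' f hf
  · rw [ModuleCat.epi_iff_surjective]
    exact BalancedTensor.mapLeft_surjective K R (Y := C.X n) hg

/-- Tensoring with a free right module is exact, so it preserves all quasi-isomorphisms. This
settles the middle term of a free presentation of `X` below. -/
instance balancedTensorFunctor_preservesHomology_free (ι : Type u) :
    (balancedTensorFunctor K R (ι →₀ Rᵐᵒᵖ)).PreservesHomology := by
  refine ((Functor.exact_tfae _).out 0 2).mp fun S hS => ?_
  refine ShortComplex.ShortExact.mk' ?_ ?_ ?_
  · rw [ShortComplex.ShortExact.moduleCat_exact_iff_function_exact]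
    exact BalancedTensor.map_exact K R
      ((ShortComplex.ShortExact.moduleCat_exact_iff_function_exact S).1 hS.exact)
      ((ModuleCat.epi_iff_surjective _).1 hS.epi_g)
  · rw [ModuleCat.mono_iff_injective]
    exact BalancedTensor.map_injective_of_free K R ι ((ModuleCat.mono_iff_injective _).1 hS.mono_f)
  · rw [ModuleCat.epi_iff_surjective]
    exact BalancedTensor.map_surjective K R ((ModuleCat.epi_iff_surjective _).1 hS.epi_g)

variable {K R} in
/-- Tensoring preserves quasi-isomorphisms between non-negative complexes of flat modules. -/
theorem isIso_homologyMap_balancedTensor {C D : ChainComplex (ModuleCat.{u} R) ℕ} (φ : C ⟶ D)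
    [QuasiIso φ] (hC : ∀ n, IsTensorFlat K R (C.X n)) (hD : ∀ n, IsTensorFlat K R (D.X n))
    (n : ℕ) (X : Type u) [AddCommGroup X] [Module K X] [Module Rᵐᵒᵖ X]
    [IsScalarTower K Rᵐᵒᵖ X] :
    IsIso (HomologicalComplex.homologyMap
      (((balancedTensorFunctor K R X).mapHomologicalComplex _).map φ) n) := by
  -- Dimension shifting: the kernel `N` of a free presentation of `X` is an arbitrary right module,
  -- so the induction on the degree must run over all `X` simultaneously. Degree `0` needs no
  -- separate case, since no degree follows it.
  induction n using Nat.strong_induction_on generalizing X with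
  | _ n ih =>
  have hrel : ∀ j, (ComplexShape.down ℕ).Rel n j → j < n := by
    intro j hj
    have : j + 1 = n := hj
    omega
  -- a presentation `0 → N → L → X → 0` with `L` free
  have key : ∀ (X : Type u) [AddCommGroup X] [Module K X] [Module Rᵐᵒᵖ X]
      [IsScalarTower K Rᵐᵒᵖ X],
      Epi (HomologicalComplex.homologyMap
        (((balancedTensorFunctor K R X).mapHomologicalComplex _).map φ) n) ∧
      ((∀ (X : Type u) [AddCommGroup X] [Module K X] [Module Rᵐᵒᵖ X]
        [IsScalarTower K Rᵐᵒᵖ X], Epi (HomologicalComplex.homologyMap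
        (((balancedTensorFunctor K R X).mapHomologicalComplex _).map φ) n)) →
        IsIso (HomologicalComplex.homologyMap
        (((balancedTensorFunctor K R X).mapHomologicalComplex _).map φ) n)) := by
    intro X _ _ _ _
    let g : (X →₀ Rᵐᵒᵖ) →ₗ[Rᵐᵒᵖ] X := Finsupp.linearCombination Rᵐᵒᵖ id
    have hg : Function.Surjective g := Finsupp.linearCombination_id_surjective _ _
    let f : LinearMap.ker g →ₗ[Rᵐᵒᵖ] (X →₀ Rᵐᵒᵖ) := (LinearMap.ker g).subtype
    have h : g ∘ₗ f = 0 := LinearMap.comp_ker_subtype g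
    have hfg : Function.Exact f g := LinearMap.exact_subtype_ker_map g
    have hSC := balancedTensorShortComplex_shortExact K R h (Submodule.injective_subtype _)
      hfg hg C hC
    have hSD := balancedTensorShortComplex_shortExact K R h (Submodule.injective_subtype _)
      hfg hg D hD
    let Φ : balancedTensorShortComplex K R h C ⟶ balancedTensorShortComplex K R h D :=
      { τ₁ := ((balancedTensorFunctor K R (LinearMap.ker g)).mapHomologicalComplex _).map φ
        τ₂ := ((balancedTensorFunctor K R (X →₀ Rᵐᵒᵖ)).mapHomologicalComplex _).map φ
        τ₃ := ((balancedTensorFunctor K R X).mapHomologicalComplex _).map φ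
        comm₁₂ := (NatTrans.mapHomologicalComplex (balancedTensorFunctorMap K R f) _).naturality φ
        comm₂₃ := (NatTrans.mapHomologicalComplex (balancedTensorFunctorMap K R g) _).naturality φ }
    have hL : ∀ j, IsIso (HomologicalComplex.homologyMap Φ.τ₂ j) := fun j => by
      have : QuasiIso Φ.τ₂ := HomologicalComplex.quasiIso_map_of_preservesHomology _ _
      infer_instance
    have hN : ∀ j, (ComplexShape.down ℕ).Rel n j →
        IsIso (HomologicalComplex.homologyMap Φ.τ₁ j) := fun j hj => ih j (hrel j hj) _
    -- A four lemma on the long exact sequences gives surjectivity for `X` in degree `n` from `N` in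
    -- degree `n - 1` alone. The five lemma also needs surjectivity for `N` in degree `n`, which
    -- becomes available once surjectivity is known for every module.
    constructor
    · exact HomologicalComplex.HomologySequence.epi_homologyMap_τ₃ Φ hSC hSD n
        (have := hL n; inferInstance) (fun j hj => have := hN j hj; inferInstance)
        (fun j _ => have := hL j; inferInstance)
    · intro hepi
      exact HomologicalComplex.HomologySequence.isIso_homologyMap_τ₃ Φ hSC hSD n
        (hepi _) (hL n) hN (fun j _ => have := hL j; inferInstance)
  exact (key X).2 fun X => (key X).1

end

/-! ## Derived functors of a composition with an exact functor -/

section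

open Limits

variable {C D : Type*} [Category* C] [Category* D] [Abelian C] [Abelian D]
  (G : C ⥤ D) [G.Additive] [G.PreservesHomology]

/-- A projective resolution of `G M` maps quasi-isomorphically to the image under the exact
functor `G` of a projective resolution of `M`. -/
theorem exists_quasiIso_map_projectiveResolution {M : C} (Q : ProjectiveResolution M)
    (P : ProjectiveResolution (G.obj M)) :
    ∃ φ : P.complex ⟶ (G.mapHomologicalComplex _).obj Q.complex, QuasiIso φ := by
  have := G.preservesFiniteColimits_of_preservesHomology
  have := G.preservesFiniteLimits_of_preservesHomology
  let ε : Q.complex.X 0 ⟶ M := Q.π.f 0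
  let η : P.complex.X 0 ⟶ G.obj M := P.π.f 0
  have : Epi ε := inferInstanceAs (Epi (Q.π.f 0))
  -- The comparison map is built by the usual lifting argument. It uses projectivity of the terms of
  -- `P` and exactness of `G Q`, which comes from exactness of `G`; the terms of `G Q` need not be
  -- projective.
  have h0 : (ShortComplex.mk (G.map (Q.complex.d 1 0)) (G.map ε) (by
      rw [← G.map_comp]; exact (congrArg G.map Q.complex_d_comp_π_f_zero).trans (G.map_zero _ _))).Exact := Q.exact₀.map G
  have hs : ∀ n, (ShortComplex.mk (G.map (Q.complex.d (n + 2) (n + 1)))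
      (G.map (Q.complex.d (n + 1) n)) (by
      rw [← G.map_comp, Q.complex.d_comp_d, G.map_zero])).Exact := fun n =>
    (Q.exact_succ n).map G
  let f0 : P.complex.X 0 ⟶ G.obj (Q.complex.X 0) :=
    Projective.factorThru η (G.map ε)
  have hf0 : f0 ≫ G.map ε = η := Projective.factorThru_comp _ _
  let f1 : P.complex.X 1 ⟶ G.obj (Q.complex.X 1) :=
    h0.liftFromProjective (P.complex.d 1 0 ≫ f0) (by
      show (_ ≫ f0) ≫ G.map ε = 0
      rw [Category.assoc, hf0]
      exact P.complex_d_comp_π_f_zero)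
  have hf1 : f1 ≫ G.map (Q.complex.d 1 0) = P.complex.d 1 0 ≫ f0 :=
    h0.liftFromProjective_comp _ _
  have step : ∀ (n : ℕ) (g : P.complex.X n ⟶ G.obj (Q.complex.X n))
      (g' : P.complex.X (n + 1) ⟶ G.obj (Q.complex.X (n + 1))),
      g' ≫ G.map (Q.complex.d (n + 1) n) = P.complex.d (n + 1) n ≫ g →
      ∃ g'' : P.complex.X (n + 2) ⟶ G.obj (Q.complex.X (n + 2)),
        g'' ≫ G.map (Q.complex.d (n + 2) (n + 1)) = P.complex.d (n + 2) (n + 1) ≫ g' :=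
    fun n g g' w => ⟨(hs n).liftFromProjective (P.complex.d (n + 2) (n + 1) ≫ g') (by
        rw [Category.assoc, w, P.complex.d_comp_d_assoc, zero_comp]),
      (hs n).liftFromProjective_comp _ _⟩
  let φ : P.complex ⟶ (G.mapHomologicalComplex _).obj Q.complex :=
    ChainComplex.mkHom _ _ f0 f1 hf1 fun n p =>
      ⟨(step n p.1 p.2.1 p.2.2).choose, (step n p.1 p.2.1 p.2.2).choose_spec⟩
  -- The augmentation `G Q → G M` is a quasi-isomorphism because `G` is exact. Since `φ` lifts the
  -- augmentation of `P`, two-out-of-three then applies to `φ`.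
  let ψ : (G.mapHomologicalComplex _).obj Q.complex ⟶ (ChainComplex.single₀ D).obj (G.obj M) :=
    (G.mapHomologicalComplex _).map Q.π ≫
      (HomologicalComplex.singleMapHomologicalComplex G (ComplexShape.down ℕ) 0).hom.app M
  have hψ : QuasiIso ψ := inferInstance
  refine ⟨φ, ?_⟩
  have hc : φ ≫ ψ = P.π := by
    ext
    have : ψ.f 0 = G.map ε := by
      have h1 : ψ.f 0 = G.map ε ≫ ((HomologicalComplex.singleMapHomologicalComplex G
        (ComplexShape.down ℕ) 0).hom.app M).f 0 := rfl
      have h2 : ((HomologicalComplex.singleMapHomologicalComplex G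
        (ComplexShape.down ℕ) 0).hom.app M).f 0 = 𝟙 (G.obj M) := by
        refine (HomologicalComplex.singleMapHomologicalComplex_hom_app_self G _ 0 M).trans ?_
        exact (Category.comp_id _).trans (G.map_id M)
      exact h1.trans ((congrArg (G.map ε ≫ ·) h2).trans (Category.comp_id _))
    rw [HomologicalComplex.comp_f, this]
    exact hf0
  have : QuasiIso (φ ≫ ψ) := hc ▸ P.quasiIso
  exact quasiIso_of_comp_right φ ψ

end

section

variable {K : Type u} [CommRing K] {R : Type u} [Ring R] [Algebra K R] {L : Type u} [Ring L]
variable (X : Type u) [AddCommGroup X] [Module K X] [Module Rᵐᵒᵖ X] [IsScalarTower K Rᵐᵒᵖ X]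

/-- If `G` is exact and maps projective modules to flat modules, then
`Tor_n(X, G M)` is the `n`-th left derived functor of `X ⊗_R G -` at `M`. -/
theorem nonempty_algebraTor_iso_leftDerived (G : ModuleCat.{u} L ⥤ ModuleCat.{u} R) [G.Additive]
    [G.PreservesHomology] (hG : ∀ Q : ModuleCat.{u} L, Projective Q → IsTensorFlat K R (G.obj Q))
    (H : ModuleCat.{u} L ⥤ ModuleCat.{u} K) [H.Additive]
    (e : G ⋙ balancedTensorFunctor K R X ≅ H) (M : ModuleCat.{u} L) (n : ℕ) :
    Nonempty (algebraTor K R X n (G.obj M) ≅ (H.leftDerived n).obj M) := by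
  let Q := projectiveResolution M
  let P := projectiveResolution (G.obj M)
  -- Both `P` and `G Q` consist of flat modules, so `X ⊗ φ` is still an isomorphism on homology. One
  -- side computes Tor, the other the derived functors of `H ≅ X ⊗ G(-)`.
  obtain ⟨φ, hφ⟩ := exists_quasiIso_map_projectiveResolution G Q P
  have h := isIso_homologyMap_balancedTensor (K := K) φ
    (fun n => isTensorFlat_of_projective K R _) (fun n => hG _ (Q.projective n)) n X
  have i : ((balancedTensorFunctor K R X).mapHomologicalComplex _).obj
      ((G.mapHomologicalComplex _).obj Q.complex) ≅ (H.mapHomologicalComplex _).obj Q.complex :=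
    (NatIso.mapHomologicalComplex e (ComplexShape.down ℕ)).app Q.complex
  exact ⟨P.isoLeftDerivedObj _ n ≪≫ @asIso _ _ _ _ _ h ≪≫
    (HomologicalComplex.homologyFunctor _ _ n).mapIso i ≪≫ (Q.isoLeftDerivedObj H n).symm⟩

end

/-! ## Flatness over the algebra of a semilattice -/

theorem IsLocalRing.eq_zero_or_one_of_isIdempotentElem {R : Type*} [CommRing R] [IsLocalRing R]
    {e : R} (he : IsIdempotentElem e) : e = 0 ∨ e = 1 := by
  have he' : e * e = e := he
  rcases IsLocalRing.isUnit_or_isUnit_one_sub_self e with h | h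
  · exact Or.inr (h.mul_left_cancel (by rw [he', mul_one]))
  · exact Or.inl (h.mul_left_cancel (by rw [sub_mul, one_mul, he', sub_self, mul_zero]))

/-- All modules over a commutative algebra over a field that is spanned by idempotents are
flat. -/
theorem Module.flat_of_span_isIdempotentElem {K D : Type*} [Field K] [CommRing D] [Algebra K D]
    (h : Submodule.span K {e : D | IsIdempotentElem e} = ⊤) (M : Type*) [AddCommGroup M]
    [Module D M] : Module.Flat D M := by
  refine Module.flat_of_localized_maximal M fun P _ => ?_
  -- In a local ring the only idempotents are `0` and `1`. As idempotents span `D`, every element of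
  -- `D` becomes a scalar from `K` after localizing at a prime.
  have hscalar : ∀ d : D, ∃ k : K,
      algebraMap D (Localization.AtPrime P) d = algebraMap K (Localization.AtPrime P) k := by
    intro d
    have hd : d ∈ Submodule.span K {e : D | IsIdempotentElem e} := h ▸ Submodule.mem_top
    induction hd using Submodule.span_induction with
    | mem e he =>
      rcases IsLocalRing.eq_zero_or_one_of_isIdempotentElem
        (IsIdempotentElem.map he (algebraMap D (Localization.AtPrime P))) with h | h
      · exact ⟨0, by rw [h, map_zero]⟩
      · exact ⟨1, by rw [h, map_one]⟩
    | zero => exact ⟨0, by rw [map_zero, map_zero]⟩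
    | add x y _ _ hx hy =>
      obtain ⟨k, hk⟩ := hx
      obtain ⟨l, hl⟩ := hy
      exact ⟨k + l, by rw [map_add, map_add, hk, hl]⟩
    | smul c x _ hx =>
      obtain ⟨k, hk⟩ := hx
      refine ⟨c * k, ?_⟩
      rw [Algebra.smul_def, map_mul, map_mul, hk, ← IsScalarTower.algebraMap_apply]
  -- For a nonzero fraction `d / s` the numerator is a nonzero scalar `k`, so `k⁻¹ s` is an inverse.
  -- Flatness over the localization is then automatic.
  have hfield : IsField (Localization.AtPrime P) := by
    refine ⟨exists_pair_ne _, mul_comm, fun {z} hz => ?_⟩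
    obtain ⟨d, s, rfl⟩ := IsLocalization.exists_mk'_eq P.primeCompl z
    obtain ⟨k, hk⟩ := hscalar d
    have hk0 : k ≠ 0 := by
      rintro rfl
      apply hz
      rw [IsLocalization.mk'_eq_mul_mk'_one, hk, map_zero, zero_mul]
    refine ⟨algebraMap K _ k⁻¹ * algebraMap D _ s, ?_⟩
    rw [mul_comm, mul_assoc, IsLocalization.mk'_spec', hk, ← map_mul, inv_mul_cancel₀ hk0, map_one]
  let := hfield.toField
  have : Module.Flat (Localization.AtPrime P) (LocalizedModule P.primeCompl M) := inferInstance
  have : Module.Flat D (Localization.AtPrime P) := IsLocalization.flat _ P.primeCompl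
  exact Module.Flat.trans D (Localization.AtPrime P) (LocalizedModule P.primeCompl M)

/-- The idempotents of an inverse monoid. -/
def Idem (S : Type u) [InverseMonoid S] : Type u := {e : S // IsIdempotentElem e}

namespace Idem

variable {S : Type u} [InverseMonoid S]

instance : CommMonoid (Idem S) where
  mul e f := ⟨e.1 * f.1, idem_mul e.2 f.2⟩
  mul_assoc e f g := Subtype.ext (mul_assoc e.1 f.1 g.1)
  one := ⟨1, one_mul 1⟩
  one_mul e := Subtype.ext (one_mul e.1)
  mul_one e := Subtype.ext (mul_one e.1)
  mul_comm e f := Subtype.ext (idem_comm e.2 f.2)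

variable (S) in
/-- The inclusion `E(S) → S`. -/
def val : Idem S →* S where
  toFun e := e.1
  map_one' := rfl
  map_mul' _ _ := rfl

end Idem

/-- The monoid basis of `KE(S)` consists of idempotents. Through this flatness the assumption that
`K` is a field enters the main argument. -/
theorem Idem.flat {K S : Type u} [Field K] [InverseMonoid S] (M : Type*) [AddCommGroup M]
    [Module (MonoidAlgebra K (Idem S)) M] : Module.Flat (MonoidAlgebra K (Idem S)) M := by
  refine Module.flat_of_span_isIdempotentElem (K := K) ?_ M
  rw [eq_top_iff]
  intro d _
  induction d using MonoidAlgebra.induction_linear with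
  | zero => exact Submodule.zero_mem _
  | add f g hf hg => exact Submodule.add_mem _ (hf trivial) (hg trivial)
  | single e k =>
    have : MonoidAlgebra.single e k = k • (MonoidAlgebra.single e 1 : MonoidAlgebra K (Idem S)) := by
      simp
    rw [this]
    refine Submodule.smul_mem _ _ (Submodule.subset_span ?_)
    show MonoidAlgebra.single e 1 * MonoidAlgebra.single e 1 = _
    rw [MonoidAlgebra.single_mul_single, one_mul]
    congr 1
    exact Subtype.ext e.2

/-! ## The crossed product -/

namespace UnitalAction

variable {K S A : Type u} [CommRing K] [InverseMonoid S] [Ring A] [Algebra K A]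
variable (T : UnitalAction K S A)

/-- Factoring `a δ_s` as `a δ_1 · 1_s δ_s` makes the crossed product additively generated by
products of an element from `A` and one from `S`; later verifications are made on such products. -/
theorem toCrossed_delta (s : S) (a : A) :
    T.toCrossed (T.delta s a) = T.ofBase a * T.ofMonoid s := by
  show _ = T.toCrossed _ * T.toCrossed _
  rw [← map_mul, T.delta_mul_delta _ _ _ _ (by rw [T.unit_one, one_mul]) (T.unit_mul_unit s),
    T.act_one, one_mul]
  congr 1
  apply Subtype.ext
  show Finsupp.single s _ = Finsupp.single s _
  rw [← T.unit_central, ← mul_assoc, T.unit_mul_unit]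

theorem toCrossed_smul (k : K) (f : T.SkewAlgebra) :
    T.toCrossed (k • f) = k • T.toCrossed f := rfl

theorem toCrossed_surjective : Function.Surjective T.toCrossed :=
  RingCon.mk'_surjective _

theorem skewAlgebra_induction {p : T.SkewAlgebra → Prop} (h0 : p 0)
    (ha : ∀ f g, p f → p g → p (f + g)) (hs : ∀ s a, p (T.delta s a)) (f : T.SkewAlgebra) :
    p f := by
  obtain ⟨f, hf⟩ := f
  have : ∃ h : f ∈ T.skewSubmodule, p ⟨f, h⟩ := by
    refine T.skew_induction (p := fun f => ∃ h : f ∈ T.skewSubmodule, p ⟨f, h⟩) ⟨_, h0⟩ ?_ ?_ hf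
    · rintro f g ⟨hf, hf'⟩ ⟨hg, hg'⟩
      exact ⟨_, ha _ _ hf' hg'⟩
    · intro s a h
      refine ⟨T.single_mem h, ?_⟩
      have e : (⟨Finsupp.single s a, T.single_mem h⟩ : T.SkewAlgebra) = T.delta s a :=
        Subtype.ext (congrArg (Finsupp.single s) h.symm)
      exact e ▸ hs s a
  exact this.2

theorem crossedProduct_induction {p : T.CrossedProduct → Prop} (h0 : p 0)
    (ha : ∀ f g, p f → p g → p (f + g)) (hs : ∀ a s, p (T.ofBase a * T.ofMonoid s))
    (b : T.CrossedProduct) : p b := by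
  obtain ⟨f, rfl⟩ := T.toCrossed_surjective b
  induction f using T.skewAlgebra_induction with
  | h0 => rwa [map_zero]
  | ha f g hf hg => rw [map_add]; exact ha _ _ hf hg
  | hs s a => rw [toCrossed_delta]; exact hs a s

/-- The homomorphism `A → A ⋊_θ S` as an algebra homomorphism. -/
noncomputable def ofBaseHom : A →ₐ[K] T.CrossedProduct :=
  AlgHom.ofLinearMap
    { toFun := T.ofBase
      map_add' := fun a b => by
        show T.toCrossed _ = T.toCrossed _ + T.toCrossed _
        rw [← map_add]
        congr 1
        apply Subtype.ext
        show Finsupp.single 1 _ = Finsupp.single 1 _ + Finsupp.single 1 _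
        rw [mul_add, Finsupp.single_add]
      map_smul' := fun k a => by
        show T.toCrossed _ = k • T.toCrossed _
        rw [← toCrossed_smul]
        congr 1
        apply Subtype.ext
        show Finsupp.single 1 _ = k • Finsupp.single 1 _
        rw [mul_smul_comm, Finsupp.smul_single] }
    (by
      show T.toCrossed _ = 1
      rw [← map_one T.toCrossed]
      congr 1
      apply Subtype.ext
      show Finsupp.single 1 _ = Finsupp.single 1 _
      rw [T.unit_one, one_mul])
    (fun a b => by
      show T.toCrossed _ = T.toCrossed _ * T.toCrossed _
      rw [← map_mul, T.delta_mul_delta _ _ _ _ (by rw [T.unit_one, one_mul])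
        (by rw [T.unit_one, one_mul]), T.act_one, one_mul])

theorem ofBaseHom_apply (a : A) : T.ofBaseHom a = T.ofBase a := rfl

theorem toCrossed_delta_eq {s t : S} (h : NatLE s t) {a : A} (ha : T.unit s * a = a) :
    T.ofBase a * T.ofMonoid s = T.ofBase a * T.ofMonoid t := by
  rw [← toCrossed_delta, ← toCrossed_delta]
  refine (RingCon.eq _).2 ?_
  rw [TwoSidedIdeal.rel_iff]
  exact TwoSidedIdeal.subset_span ⟨s, t, a, h, ha, rfl⟩

/-- Since `e ≤ 1`, the order relations identify `1_e δ_e` with `1_e δ_1`. Thus idempotents of `S`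
act through central idempotents of `A`, and modulo `[A, Y]` they may be moved from one side of `Y`
to the other. -/
theorem ofMonoid_idem {e : S} (he : IsIdempotentElem e) :
    T.ofMonoid e = T.ofBase (T.unit e) := by
  have h := T.toCrossed_delta_eq (s := e) (t := 1) ⟨e, he, (mul_one e).symm⟩ (T.unit_mul_unit e)
  rw [map_one, mul_one, ← toCrossed_delta] at h
  exact h

theorem ofMonoid_idem_comm {e : S} (he : IsIdempotentElem e) (a : A) :
    T.ofMonoid e * T.ofBase a = T.ofBase a * T.ofMonoid e := by
  rw [T.ofMonoid_idem he, ← ofBaseHom_apply, ← ofBaseHom_apply, ← map_mul, ← map_mul,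
    T.unit_central]

end UnitalAction

/-! ## The functor `Y ↦ Y / [A, Y]` -/

namespace UnitalAction

variable {K S A : Type u} [CommRing K] [InverseMonoid S] [Ring A] [Algebra K A]
variable (T : UnitalAction K S A)

/-- The homomorphism `s ↦ δ_s ⊗ δ_{s⁻¹}` from `S` to the enveloping algebra of `A ⋊_θ S`. -/
noncomputable def conjHom : S →* Env K T.CrossedProduct where
  toFun s := T.ofMonoid s ⊗ₜ[K] op (T.ofMonoid s⁻¹)
  map_one' := by rw [one_inv, map_one]; rfl
  map_mul' s t := by
    rw [mul_inv_rev', map_mul, map_mul, op_mul, Algebra.TensorProduct.tmul_mul_tmul]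

theorem conjHom_apply (s : S) : T.conjHom s = T.ofMonoid s ⊗ₜ[K] op (T.ofMonoid s⁻¹) := rfl

/-- The homomorphism from `KS` to the enveloping algebra of `A ⋊_θ S`. -/
noncomputable def conjAlgHom : MonoidAlgebra K S →ₐ[K] Env K T.CrossedProduct :=
  MonoidAlgebra.lift K (Env K T.CrossedProduct) S T.conjHom

theorem conjAlgHom_single (s : S) (k : K) :
    T.conjAlgHom (MonoidAlgebra.single s k) = k • T.conjHom s :=
  MonoidAlgebra.lift_single _ _ _

/-- The element `a ⊗ 1 - 1 ⊗ a` of the enveloping algebra of `A ⋊_θ S`. -/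
noncomputable def comm (a : A) : Env K T.CrossedProduct :=
  T.ofBase a ⊗ₜ[K] 1 - 1 ⊗ₜ[K] op (T.ofBase a)

/-- Both covariance relations between `δ_s` and `A` are combined here; this is why `[A, Y]` is
stable under `S`. -/
theorem conjHom_mul_comm (s : S) (a : A) :
    T.conjHom s * T.comm a = T.comm (T.act s a) * T.conjHom s := by
  rw [conjHom_apply, comm, comm, mul_sub, sub_mul]
  simp only [Algebra.TensorProduct.tmul_mul_tmul, mul_one, one_mul, ← op_mul]
  rw [T.ofMonoid_mul_ofBase, T.ofBase_mul_ofMonoid_inv]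

/-- Scalars are absorbed into `a`, so the additive subgroup generated by commutators is already a
`K`-subspace. -/
theorem smul_comm_eq (k : K) (a : A) : k • T.comm a = T.comm (k • a) := by
  rw [comm, comm, ← ofBaseHom_apply, ← ofBaseHom_apply, map_smul, smul_sub, MulOpposite.op_smul,
    TensorProduct.smul_tmul', TensorProduct.tmul_smul]

section

variable (Y : Type u) [AddCommGroup Y] [Module (Env K T.CrossedProduct) Y]

/-- The subgroup `[A, Y]`, for a module `Y` over the enveloping algebra of `A ⋊_θ S`. -/
def commSubgroup : AddSubgroup Y :=
  AddSubgroup.closure {z : Y | ∃ (a : A) (y : Y), z = T.comm a • y}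

variable {Y}

theorem comm_smul_mem (a : A) (y : Y) : T.comm a • y ∈ T.commSubgroup Y :=
  AddSubgroup.subset_closure ⟨a, y, rfl⟩

theorem commSubgroup_le {G : AddSubgroup Y} (h : ∀ (a : A) (y : Y), T.comm a • y ∈ G) :
    T.commSubgroup Y ≤ G := by
  refine (AddSubgroup.closure_le G).2 ?_
  rintro _ ⟨a, y, rfl⟩
  exact h a y

theorem conjAlgHom_smul_mem (r : MonoidAlgebra K S) {z : Y} (hz : z ∈ T.commSubgroup Y) :
    T.conjAlgHom r • z ∈ T.commSubgroup Y := by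
  induction r using MonoidAlgebra.induction_linear with
  | zero =>
    have h : T.conjAlgHom 0 • z = 0 := by
      rw [map_zero]
      exact zero_smul (Env K T.CrossedProduct) z
    exact h ▸ AddSubgroup.zero_mem _
  | add r r' h h' => rw [map_add, add_smul]; exact AddSubgroup.add_mem _ h h'
  | single s k =>
    refine T.commSubgroup_le (G := (T.commSubgroup Y).comap
      (DistribSMul.toAddMonoidHom Y (T.conjAlgHom (MonoidAlgebra.single s k)))) ?_ hz
    intro a y
    have := T.comm_smul_mem (k • T.act s a) (T.conjHom s • y)
    rwa [← smul_comm_eq, ← mul_smul, smul_mul_assoc, ← conjHom_mul_comm, ← smul_mul_assoc,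
      ← conjAlgHom_single, mul_smul] at this

end

/-- The restriction of a module over the enveloping algebra to `KS`. -/
noncomputable abbrev conjRestrict : ModuleCat.{u} (Env K T.CrossedProduct) ⥤
    ModuleCat.{u} (MonoidAlgebra K S) :=
  ModuleCat.restrictScalars T.conjAlgHom.toRingHom

/-- The `KS`-submodule `[A, Y]`. -/
noncomputable def commSubmodule (Y : ModuleCat.{u} (Env K T.CrossedProduct)) :
    Submodule (MonoidAlgebra K S) (T.conjRestrict.obj Y) :=
  { T.commSubgroup Y with
    smul_mem' := fun r _ hz => T.conjAlgHom_smul_mem (Y := Y) r hz }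

theorem commSubmodule_le_comap {Y Z : ModuleCat.{u} (Env K T.CrossedProduct)} (f : Y ⟶ Z) :
    T.commSubmodule Y ≤ (T.commSubmodule Z).comap (T.conjRestrict.map f).hom := by
  refine T.commSubgroup_le (Y := Y) (G := (T.commSubgroup Z).comap f.hom.toAddMonoidHom) ?_
  intro a y
  show f.hom (T.comm a • y) ∈ T.commSubgroup Z
  rw [map_smul]
  exact T.comm_smul_mem a _

/-- The functor `Y ↦ Y / [A, Y]`. -/
noncomputable def coinvFunctor : ModuleCat.{u} (Env K T.CrossedProduct) ⥤
    ModuleCat.{u} (MonoidAlgebra K S) where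
  obj Y := ModuleCat.of _ (T.conjRestrict.obj Y ⧸ T.commSubmodule Y)
  map f := ModuleCat.ofHom (Submodule.mapQ _ _ (T.conjRestrict.map f).hom
    (T.commSubmodule_le_comap f))
  map_id Y := by
    ext : 1
    exact Submodule.linearMap_qext _ rfl
  map_comp f g := by
    ext : 1
    exact Submodule.linearMap_qext _ rfl

instance : T.coinvFunctor.Additive where
  map_add := by
    intros
    ext : 1
    exact Submodule.linearMap_qext _ rfl

section

variable {T}
variable {Y Z : ModuleCat.{u} (Env K T.CrossedProduct)}

/-- The class of `y` in `Y / [A, Y]`. -/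
noncomputable def coinvMk (y : Y) : T.coinvFunctor.obj Y :=
  Submodule.Quotient.mk (p := T.commSubmodule Y) (show T.conjRestrict.obj Y from y)

theorem coinvMk_surjective : Function.Surjective (coinvMk (T := T) (Y := Y)) :=
  Submodule.Quotient.mk_surjective (T.commSubmodule Y)

theorem coinvMk_eq_zero {y : Y} : coinvMk (T := T) y = 0 ↔ y ∈ T.commSubgroup Y :=
  Submodule.Quotient.mk_eq_zero (T.commSubmodule Y)

theorem coinvMk_add (y y' : Y) : coinvMk (T := T) (y + y') = coinvMk y + coinvMk y' := rfl

theorem coinvMk_sub (y y' : Y) : coinvMk (T := T) (y - y') = coinvMk y - coinvMk y' := rfl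

theorem smul_coinvMk (r : MonoidAlgebra K S) (y : Y) :
    r • coinvMk (T := T) y = coinvMk (T.conjAlgHom r • y) := rfl

theorem coinvMk_comm (a : A) (y : Y) :
    coinvMk (T := T) ((T.ofBase a ⊗ₜ[K] 1 : Env K T.CrossedProduct) • y) =
      coinvMk ((1 ⊗ₜ[K] op (T.ofBase a) : Env K T.CrossedProduct) • y) := by
  rw [← sub_eq_zero, ← coinvMk_sub, coinvMk_eq_zero, ← sub_smul]
  exact T.comm_smul_mem a y

attribute [local instance] algebraModule algebraModule_isScalarTower

theorem coinvMk_smul (k : K) (y : Y) : coinvMk (T := T) (k • y) = k • coinvMk y := by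
  have h : k • coinvMk (T := T) y = algebraMap K (MonoidAlgebra K S) k • coinvMk y := rfl
  rw [h, smul_coinvMk, AlgHom.commutes]
  rfl

/-- A linear map that kills `[A, Y]` factors through `Y / [A, Y]`. -/
noncomputable def coinvLift {V : Type*} [AddCommGroup V] [Module K V] (φ : Y →ₗ[K] V)
    (h : ∀ (a : A) (y : Y), φ (T.comm a • y) = 0) : T.coinvFunctor.obj Y →ₗ[K] V where
  toFun := QuotientAddGroup.lift (T.commSubmodule Y).toAddSubgroup φ.toAddMonoidHom <| by
    exact T.commSubgroup_le (Y := Y) (G := φ.toAddMonoidHom.ker) h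
  map_add' := map_add _
  map_smul' k z := by
    obtain ⟨y, rfl⟩ := coinvMk_surjective z
    rw [← coinvMk_smul]
    exact φ.map_smul k y

theorem coinvLift_mk {V : Type*} [AddCommGroup V] [Module K V] (φ : Y →ₗ[K] V)
    (h : ∀ (a : A) (y : Y), φ (T.comm a • y) = 0) (y : Y) :
    coinvLift φ h (coinvMk y) = φ y := rfl

end

/-! ### Exactness for separable algebras -/

/-- The map `a ⊗ b ↦ b ⊗ a` from the enveloping algebra of `A` to that of `A ⋊_θ S`. -/
noncomputable def flipEnv : Env K A →ₗ[K] Env K T.CrossedProduct :=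
  TensorProduct.lift <| LinearMap.mk₂ K
    (fun a b => T.ofBaseHom (unop b) ⊗ₜ[K] op (T.ofBaseHom a))
    (fun a a' b => by rw [map_add, MulOpposite.op_add, TensorProduct.tmul_add])
    (fun k a b => by rw [map_smul, MulOpposite.op_smul, TensorProduct.tmul_smul])
    (fun a b b' => by rw [MulOpposite.unop_add, map_add, TensorProduct.add_tmul])
    (fun k a b => by rw [MulOpposite.unop_smul, map_smul, TensorProduct.smul_tmul'])

theorem flipEnv_tmul (a b : A) :
    T.flipEnv (a ⊗ₜ[K] op b) = T.ofBase b ⊗ₜ[K] op (T.ofBase a) := rfl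

/-- Exchanging the tensor factors turns the failure of `p` to commute with `a` into right
multiplication by the commutator `a ⊗ 1 - 1 ⊗ a`. Consequently the flip of a separability element
annihilates `[A, Y]`. -/
theorem flipEnv_mul_comm (p : Env K A) (a : A) :
    T.flipEnv p * T.comm a =
      T.flipEnv ((1 ⊗ₜ[K] op a : Env K A) * p - (a ⊗ₜ[K] 1 : Env K A) * p) := by
  induction p using TensorProduct.induction_on with
  | zero => simp
  | add p q hp hq => rw [map_add, add_mul, hp, hq, ← map_add]; congr 1; noncomm_ring
  | tmul b c =>
    obtain ⟨c, rfl⟩ := op_surjective c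
    rw [Algebra.TensorProduct.tmul_mul_tmul, Algebra.TensorProduct.tmul_mul_tmul, one_mul, one_mul,
      ← op_mul, map_sub, flipEnv_tmul, flipEnv_tmul, flipEnv_tmul, comm, mul_sub,
      Algebra.TensorProduct.tmul_mul_tmul, Algebra.TensorProduct.tmul_mul_tmul, mul_one, mul_one,
      ← op_mul]
    simp only [← ofBaseHom_apply, map_mul]

variable {T} in
/-- If `A` is separable, `[A, Y]` is the kernel of multiplication by an element of the enveloping
algebra. -/
theorem exists_mem_commSubgroup_iff (hA : IsSeparableAlgebra K A) :
    ∃ ε : Env K T.CrossedProduct, ∀ (Y : Type u) [AddCommGroup Y]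
      [Module (Env K T.CrossedProduct) Y] (y : Y),
      (y ∈ T.commSubgroup Y ↔ ε • y = 0) ∧ y - ε • y ∈ T.commSubgroup Y := by
  let := envLeftModule K A A
  have : Module.Projective (Env K A) A := hA
  let μ : Env K A →ₗ[Env K A] A := LinearMap.toSpanSingleton _ _ 1
  have hμ : ∀ a b : A, μ (a ⊗ₜ[K] op b) = a * b := by
    intro a b
    show (a ⊗ₜ[K] op b : Env K A) • (1 : A) = _
    rw [envLeftModule_smul, op_smul_eq_mul, one_mul, smul_eq_mul]
  have hμs : Function.Surjective μ := fun a => ⟨a ⊗ₜ[K] op 1, by rw [hμ, mul_one]⟩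
  obtain ⟨s, hs⟩ := Module.projective_lifting_property μ LinearMap.id hμs
  -- The separability element: the image of `1` under a bimodule section of the multiplication map
  -- `μ`.
  set p := s 1 with hp
  have hp1 : μ p = 1 := LinearMap.congr_fun hs 1
  have hpa : ∀ a : A, (1 ⊗ₜ[K] op a : Env K A) * p - (a ⊗ₜ[K] 1 : Env K A) * p = 0 := by
    intro a
    rw [hp, ← smul_eq_mul, ← smul_eq_mul, ← map_smul, ← map_smul, ← map_sub, ← op_one (α := A),
      envLeftModule_smul, envLeftModule_smul]
    simp
  -- For `q = a ⊗ b` the flip sends `y` to `b y a`, which is congruent to `y a b = y μ(q)` modulo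
  -- `[A, Y]`. With `q = p` and `μ(p) = 1` this gives `ε y ≡ y`.
  have hdiff : ∀ (q : Env K A) (Y : Type u) [AddCommGroup Y]
      [Module (Env K T.CrossedProduct) Y] (y : Y),
      (1 ⊗ₜ[K] op (T.ofBase (μ q)) : Env K T.CrossedProduct) • y - T.flipEnv q • y
        ∈ T.commSubgroup Y := by
    intro q Y _ _ y
    induction q using TensorProduct.induction_on with
    | zero =>
      rw [map_zero, map_zero, ← ofBaseHom_apply, map_zero, op_zero, TensorProduct.tmul_zero,
        sub_self]
      exact AddSubgroup.zero_mem _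
    | add q q' h h' =>
      have := AddSubgroup.add_mem _ h h'
      rw [map_add, map_add, ← ofBaseHom_apply, map_add, MulOpposite.op_add, TensorProduct.tmul_add,
        add_smul, add_smul, add_sub_add_comm]
      exact this
    | tmul a b =>
      obtain ⟨b, rfl⟩ := op_surjective b
      have := AddSubgroup.neg_mem _
        (T.comm_smul_mem b ((1 ⊗ₜ[K] op (T.ofBase a) : Env K T.CrossedProduct) • y))
      rw [hμ, flipEnv_tmul, ← ofBaseHom_apply, map_mul, ← sub_smul]
      convert this using 1
      rw [← mul_smul, comm, sub_mul, sub_smul, sub_smul, neg_sub, Algebra.TensorProduct.tmul_mul_tmul,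
        Algebra.TensorProduct.tmul_mul_tmul, one_mul, one_mul, ← op_mul, mul_one]
      rfl
  refine ⟨T.flipEnv p, fun Y _ _ y => ?_⟩
  have hy : y - T.flipEnv p • y ∈ T.commSubgroup Y := by
    have := hdiff p Y y
    rw [hp1, ← ofBaseHom_apply, map_one, op_one, ← Algebra.TensorProduct.one_def, one_smul] at this
    exact this
  refine ⟨⟨fun h => ?_, fun h => ?_⟩, hy⟩
  · refine T.commSubgroup_le
      (G := (DistribSMul.toAddMonoidHom Y (T.flipEnv p)).ker) (fun a y => ?_) h
    show T.flipEnv p • T.comm a • y = 0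
    rw [← mul_smul, flipEnv_mul_comm, hpa, map_zero]
    exact zero_smul (Env K T.CrossedProduct) y
  · rwa [h, sub_zero] at hy

/-- If `g y` lies in `[A, -]`, then `g (ε y) = ε (g y) = 0`, so `ε y` comes from some `x`; as `ε y ≡
y`, the class of `x` maps to the class of `y`. It matters that one `ε` serves all modules. -/
theorem coinvFunctor_preservesHomology (hA : IsSeparableAlgebra K A) :
    T.coinvFunctor.PreservesHomology := by
  obtain ⟨ε, hε⟩ := exists_mem_commSubgroup_iff (T := T) hA
  refine ((Functor.exact_tfae _).out 1 2).mp fun Q hQ => ?_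
  rw [ShortComplex.ShortExact.moduleCat_exact_iff_function_exact] at hQ ⊢
  intro z
  obtain ⟨y, rfl⟩ := coinvMk_surjective z
  constructor
  · intro h
    have h' : coinvMk (T := T) (Q.g.hom y) = 0 := h
    rw [coinvMk_eq_zero, (hε _ _).1, ← map_smul] at h'
    obtain ⟨x, hx⟩ := (hQ _).1 h'
    refine ⟨coinvMk x, ?_⟩
    show coinvMk (T := T) (Q.f.hom x) = coinvMk y
    have hx' : Q.f.hom x = ε • y := hx
    rw [hx', ← sub_eq_zero, ← neg_eq_zero, neg_sub, ← coinvMk_sub, coinvMk_eq_zero]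
    exact (hε _ _).2
  · rintro ⟨x, hx⟩
    obtain ⟨x, rfl⟩ := coinvMk_surjective x
    rw [← hx]
    show coinvMk (T := T) (Q.g.hom (Q.f.hom x)) = 0
    have : Q.g.hom (Q.f.hom x) = 0 := hQ.apply_apply_eq_zero x
    rw [this]
    rfl

end UnitalAction

/-! ## The bimodule `X ⊗_{KE(S)} (A ⋊_θ S)` -/

/-- An element of `E(S)`. -/
def Idem.mk {S : Type u} [InverseMonoid S] (e : S) (he : IsIdempotentElem e) : Idem S := ⟨e, he⟩

/-- Idempotents commute, in particular `e` with `t t⁻¹`. Moving an idempotent past `t` at the cost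
of conjugating it is what makes the diagonal right action on `X ⊗_{KE(S)} B` well defined. -/
theorem InverseMonoid.idem_mul_eq {S : Type u} [InverseMonoid S] {e t : S}
    (he : IsIdempotentElem e) : e * t = t * (t⁻¹ * e * t) := by
  calc e * t = e * (t * t⁻¹) * t := by rw [mul_assoc e, mul_inv_mul]
    _ = t * (t⁻¹ * e * t) := by
      rw [idem_comm he (mul_inv_idem t)]; simp only [mul_assoc]

namespace UnitalAction

variable {K S A : Type u} [CommRing K] [InverseMonoid S] [Ring A] [Algebra K A]
variable (T : UnitalAction K S A)

/-- The universal property of the crossed product. -/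
noncomputable def crossedLift {P : Type*} [Ring P] (f : T.SkewAlgebra →+* P)
    (h : ∀ (s t : S) (a : A), NatLE s t → T.unit s * a = a → f (T.delta s a) = f (T.delta t a)) :
    T.CrossedProduct →+* P :=
  RingCon.lift T.orderIdeal.ringCon f <| by
    have hle : T.orderIdeal ≤ TwoSidedIdeal.ker f := by
      refine TwoSidedIdeal.span_le.2 ?_
      rintro _ ⟨s, t, a, hst, ha, rfl⟩
      exact (TwoSidedIdeal.mem_ker f).2 (by rw [map_sub, h s t a hst ha, sub_self])
    intro x y hxy
    have hxy' : f (x - y) = 0 := (TwoSidedIdeal.mem_ker f).1 (hle (T.orderIdeal.rel_iff x y |>.1 hxy))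
    rwa [map_sub, sub_eq_zero] at hxy'

variable (X : Type u) [AddCommGroup X] [Module K X] [Module (MonoidAlgebra K S)ᵐᵒᵖ X]
  [IsScalarTower K (MonoidAlgebra K S)ᵐᵒᵖ X]

/-- The right action of `s` on a right `KS`-module. -/
noncomputable def rightAct (s : S) : X →ₗ[K] X :=
  Module.toModuleEnd K (S := (MonoidAlgebra K S)ᵐᵒᵖ) X (op (MonoidAlgebra.single s 1))

variable (K) in
theorem rightAct_apply (s : S) (x : X) :
    rightAct (K := K) X s x = (op (MonoidAlgebra.single s 1) : (MonoidAlgebra K S)ᵐᵒᵖ) • x := rfl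

theorem rightAct_mul (s t : S) (x : X) :
    rightAct (K := K) X (s * t) x = rightAct (K := K) X t (rightAct (K := K) X s x) := by
  simp only [rightAct_apply, ← mul_smul, ← op_mul, MonoidAlgebra.single_mul_single, mul_one]

theorem rightAct_one (x : X) : rightAct (K := K) X (1 : S) x = x := by
  rw [rightAct_apply, ← MonoidAlgebra.one_def, op_one, one_smul]

/-- The restriction of a right `KS`-module to `E(S)`. -/
noncomputable def idemRep : Representation K (Idem S) X where
  toFun e := rightAct X (Idem.val S e)
  map_one' := LinearMap.ext fun x => rightAct_one X x
  map_mul' e f := LinearMap.ext fun x => by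
    -- A right action of `E(S)` is also a left action because idempotents commute.
    rw [mul_comm, map_mul, rightAct_mul]
    rfl

/-- The right action of `E(S)` on the crossed product. -/
noncomputable def idemRepCrossed : Representation K (Idem S) T.CrossedProduct where
  toFun e := LinearMap.mulRight K (T.ofMonoid (Idem.val S e))
  map_one' := LinearMap.ext fun x => by simp
  map_mul' e f := LinearMap.ext fun x => by
    rw [mul_comm, map_mul, map_mul, Module.End.mul_apply]
    simp only [LinearMap.mulRight_apply, mul_assoc]

/-- The tensor product `X ⊗_{KE(S)} (A ⋊_θ S)`. -/
def Ind : Type u :=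
  TensorProduct (MonoidAlgebra K (Idem S)) (idemRep (K := K) (S := S) X).asModule
    T.idemRepCrossed.asModule

noncomputable instance : AddCommGroup (T.Ind X) :=
  inferInstanceAs (AddCommGroup (TensorProduct (MonoidAlgebra K (Idem S))
    (idemRep (K := K) (S := S) X).asModule T.idemRepCrossed.asModule))

noncomputable instance : Module K (T.Ind X) :=
  inferInstanceAs (Module K (TensorProduct (MonoidAlgebra K (Idem S))
    (idemRep (K := K) (S := S) X).asModule T.idemRepCrossed.asModule))

variable {X}

/-- The class of `x ⊗ b` in `X ⊗_{KE(S)} (A ⋊_θ S)`. -/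
noncomputable def ind (x : X) (b : T.CrossedProduct) : T.Ind X :=
  TensorProduct.tmul (MonoidAlgebra K (Idem S))
    (show (idemRep (K := K) (S := S) X).asModule from x) (show T.idemRepCrossed.asModule from b)

theorem ind_add_left (x x' : X) (b : T.CrossedProduct) :
    T.ind (x + x') b = T.ind x b + T.ind x' b := TensorProduct.add_tmul _ _ _

theorem ind_add_right (x : X) (b b' : T.CrossedProduct) :
    T.ind x (b + b') = T.ind x b + T.ind x b' := TensorProduct.tmul_add _ _ _

theorem ind_smul_left (k : K) (x : X) (b : T.CrossedProduct) :
    T.ind (k • x) b = k • T.ind x b := rfl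

theorem ind_smul_right (k : K) (x : X) (b : T.CrossedProduct) :
    T.ind x (k • b) = k • T.ind x b := by
  refine (TensorProduct.tmul_smul (R := MonoidAlgebra K (Idem S)) k
    (show (idemRep (K := K) (S := S) X).asModule from x)
    (show T.idemRepCrossed.asModule from b))

theorem ind_rightAct {e : S} (he : IsIdempotentElem e) (x : X) (b : T.CrossedProduct) :
    T.ind (rightAct (K := K) X e x) b = T.ind x (b * T.ofMonoid e) := by
  have h1 : (show (idemRep (K := K) (S := S) X).asModule from rightAct (K := K) X e x) =
      (MonoidAlgebra.single (Idem.mk e he) (1 : K)) •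
        (show (idemRep (K := K) (S := S) X).asModule from x) := by
    rw [Representation.single_smul, one_smul]
    rfl
  have h2 : (show T.idemRepCrossed.asModule from b * T.ofMonoid e) =
      (MonoidAlgebra.single (Idem.mk e he) (1 : K)) •
        (show T.idemRepCrossed.asModule from b) := by
    rw [Representation.single_smul, one_smul]
    rfl
  exact (congrArg (TensorProduct.tmul _ · _) h1).trans
    ((TensorProduct.smul_tmul _ _ _).trans (congrArg (TensorProduct.tmul _ _) h2.symm))

variable {T} in
theorem Ind.induction {p : T.Ind X → Prop} (h0 : p 0) (hm : ∀ x b, p (T.ind x b))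
    (ha : ∀ z w, p z → p w → p (z + w)) (z : T.Ind X) : p z :=
  TensorProduct.induction_on z h0 hm ha

/-- The universal property of `X ⊗_{KE(S)} (A ⋊_θ S)`. -/
noncomputable def indLift {V : Type*} [AddCommGroup V] [Module K V]
    (f : X →ₗ[K] T.CrossedProduct →ₗ[K] V)
    (h : ∀ (e : S), IsIdempotentElem e → ∀ x b,
      f (rightAct (K := K) X e x) b = f x (b * T.ofMonoid e)) : T.Ind X →ₗ[K] V :=
  let F : (idemRep (K := K) (S := S) X).asModule →+ T.idemRepCrossed.asModule →+ V :=
    (LinearMap.toAddMonoidHom'.comp f.toAddMonoidHom : X →+ T.CrossedProduct →+ V)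
  have hF : ∀ (e : Idem S) (k : K) x b,
      F ((MonoidAlgebra.single e k : MonoidAlgebra K (Idem S)) • x) b =
        F x ((MonoidAlgebra.single e k : MonoidAlgebra K (Idem S)) • b) := fun e k x b => by
    rw [Representation.single_smul, Representation.single_smul]
    refine (LinearMap.congr_fun (f.map_smul k (rightAct X e.1 x)) b).trans ?_
    refine Eq.trans ?_ ((f x).map_smul k (show T.CrossedProduct from
      T.idemRepCrossed e (T.idemRepCrossed.asModuleEquiv b))).symm
    exact congrArg (k • ·) (h e.1 e.2 x b)
  let g : T.Ind X →+ V := TensorProduct.liftAddHom F (by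
      intro r x b
      induction r using MonoidAlgebra.induction_linear with
      | zero => rw [zero_smul, zero_smul, map_zero, map_zero]; rfl
      | add r r' hr hr' => rw [add_smul, add_smul, map_add, map_add, ← hr, ← hr']; rfl
      | single e k => exact hF e k x b)
  { g with
    map_smul' := by
      intro k z
      show g (k • z) = k • g z
      induction z using Ind.induction with
      | h0 => rw [smul_zero, map_zero, smul_zero]
      | hm x b =>
        rw [← ind_smul_left]
        show f (k • x) b = k • f x b
        rw [map_smul, LinearMap.smul_apply]
      | ha z w hz hw => rw [smul_add, map_add, hz, hw, map_add, smul_add] }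

theorem indLift_ind {V : Type*} [AddCommGroup V] [Module K V]
    (f : X →ₗ[K] T.CrossedProduct →ₗ[K] V)
    (h : ∀ (e : S), IsIdempotentElem e → ∀ x b,
      f (rightAct (K := K) X e x) b = f x (b * T.ofMonoid e)) (x : X) (b : T.CrossedProduct) :
    T.indLift f h (T.ind x b) = f x b := rfl

variable {T} in
theorem Ind.hom_ext {V : Type*} [AddCommGroup V] [Module K V] {f g : T.Ind X →ₗ[K] V}
    (h : ∀ x b, f (T.ind x b) = g (T.ind x b)) : f = g := by
  ext z
  induction z using Ind.induction with
  | h0 => rw [map_zero, map_zero]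
  | hm x b => exact h x b
  | ha z w hz hw => rw [map_add, map_add, hz, hw]

/-- The map `x ⊗ b ↦ x t ⊗ c b d`. -/
noncomputable def indOp (t : S) (c d : T.CrossedProduct)
    (h : ∀ e : S, IsIdempotentElem e → T.ofMonoid e * d = d * T.ofMonoid (t⁻¹ * e * t)) :
    Module.End K (T.Ind X) :=
  T.indLift
    (LinearMap.mk₂ K (fun x b => T.ind (rightAct (K := K) X t x) (c * b * d))
      (fun x x' b => by rw [map_add, ind_add_left])
      (fun k x b => by rw [map_smul, ind_smul_left])
      (fun x b b' => by rw [mul_add, add_mul, ind_add_right])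
      (fun k x b => by rw [mul_smul_comm, smul_mul_assoc, ind_smul_right]))
    (fun e he x b => by
      -- On the first factor `e t = t (t⁻¹ e t)`. The conjugated idempotent crosses the tensor sign,
      -- and `h` moves it back through `d` as `e`.
      rw [LinearMap.mk₂_apply, LinearMap.mk₂_apply, ← rightAct_mul, idem_mul_eq he, rightAct_mul,
        T.ind_rightAct (conj_idem t he), mul_assoc _ d, ← h e he]
      simp only [mul_assoc])

theorem indOp_ind (t : S) (c d : T.CrossedProduct)
    (h : ∀ e : S, IsIdempotentElem e → T.ofMonoid e * d = d * T.ofMonoid (t⁻¹ * e * t))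
    (x : X) (b : T.CrossedProduct) :
    T.indOp t c d h (T.ind x b) = T.ind (rightAct (K := K) X t x) (c * b * d) := rfl

theorem ofMonoid_idem_mul {e : S} (he : IsIdempotentElem e) (a : A) (t : S) :
    T.ofMonoid e * (T.ofBase a * T.ofMonoid t) =
      T.ofBase a * T.ofMonoid t * T.ofMonoid (t⁻¹ * e * t) := by
  rw [mul_assoc (T.ofBase a), ← map_mul, ← idem_mul_eq he, ← mul_assoc, T.ofMonoid_idem_comm he,
    map_mul, mul_assoc]

/-- The map `x ⊗ b ↦ x t ⊗ b a δ_t`, linear in `a`. -/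
noncomputable def indRight (t : S) : A →ₗ[K] Module.End K (T.Ind X) where
  toFun a := T.indOp t 1 (T.ofBase a * T.ofMonoid t) fun _ he => T.ofMonoid_idem_mul he a t
  map_add' a a' := Ind.hom_ext fun x b => by
    simp only [LinearMap.add_apply, indOp_ind, ← ofBaseHom_apply, map_add, add_mul, mul_add,
      ind_add_right]
  map_smul' k a := Ind.hom_ext fun x b => by
    simp only [LinearMap.smul_apply, RingHom.id_apply, indOp_ind, ← ofBaseHom_apply, map_smul,
      smul_mul_assoc, mul_smul_comm, ind_smul_right]

theorem indRight_ind (t : S) (a : A) (x : X) (b : T.CrossedProduct) :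
    T.indRight t a (T.ind x b) =
      T.ind (rightAct (K := K) X t x) (b * (T.ofBase a * T.ofMonoid t)) :=
  congrArg (fun c => T.ind (rightAct (K := K) X t x) (c * (T.ofBase a * T.ofMonoid t))) (one_mul b)

theorem indRight_mul (s t : S) (a b : A) (z : T.Ind X) :
    T.indRight (s * t) (a * T.act s b) z = T.indRight t b (T.indRight s a z) := by
  induction z using Ind.induction with
  | h0 => simp only [map_zero]
  | hm x c =>
    rw [indRight_ind, indRight_ind, indRight_ind, rightAct_mul]
    congr 1
    rw [mul_assoc, mul_assoc (T.ofBase a), ← mul_assoc (T.ofMonoid s), T.ofMonoid_mul_ofBase,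
      map_mul, ← ofBaseHom_apply, ← ofBaseHom_apply, ← ofBaseHom_apply, map_mul]
    simp only [mul_assoc]
  | ha z w hz hw => simp only [map_add, hz, hw]

variable (X) in
/-- The right action of the algebra `⊕_s 1_s A δ_s` on `X ⊗_{KE(S)} (A ⋊_θ S)`. -/
noncomputable def indSkew : T.SkewAlgebra →+* (Module.End K (T.Ind X))ᵐᵒᵖ :=
  let φ : (S →₀ A) →ₗ[K] Module.End K (T.Ind X) := Finsupp.lsum K T.indRight
  have hφ : ∀ f g : S →₀ A, φ (T.mulAux f g) = φ g * φ f := by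
    intro f g
    induction f using Finsupp.induction_linear with
    | zero => simp
    | add f f' hf hf' => simp only [map_add, LinearMap.add_apply, hf, hf', mul_add]
    | single s a =>
      induction g using Finsupp.induction_linear with
      | zero => simp
      | add g g' hg hg' => simp only [map_add, hg, hg', add_mul]
      | single t b =>
        simp only [mulAux_single, φ, Finsupp.lsum_single]
        exact LinearMap.ext fun z => T.indRight_mul s t a b z
  { toFun := fun f => op (φ f.1)
    map_one' := by
      refine congrArg op ?_
      show φ (Finsupp.single 1 1) = 1
      simp only [φ, Finsupp.lsum_single]
      refine Ind.hom_ext fun x b => ?_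
      rw [indRight_ind, rightAct_one, map_one, ← ofBaseHom_apply, map_one, mul_one, mul_one]
      rfl
    map_mul' := fun f g => congrArg op (hφ f.1 g.1)
    map_zero' := congrArg op (map_zero φ)
    map_add' := fun f g => congrArg op (map_add φ f.1 g.1) }

theorem indSkew_delta (s : S) (a : A) :
    T.indSkew X (T.delta s a) = op (T.indRight s (T.unit s * a)) :=
  congrArg op (Finsupp.lsum_single _ _ _ _)

theorem indSkew_smul (k : K) (f : T.SkewAlgebra) :
    T.indSkew X (k • f) = k • T.indSkew X f :=
  congrArg op (map_smul _ k f.1)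

variable (X) in
/-- The right action of the crossed product on `X ⊗_{KE(S)} (A ⋊_θ S)`. -/
noncomputable def indCrossed : T.CrossedProduct →+* (Module.End K (T.Ind X))ᵐᵒᵖ :=
  T.crossedLift (T.indSkew X) <| by
    intro s t a hst ha
    rw [indSkew_delta, indSkew_delta, ha, T.unit_mul_of_natLE hst ha]
    refine congrArg op (Ind.hom_ext fun x b => ?_)
    rw [indRight_ind, indRight_ind, T.toCrossed_delta_eq hst ha]
    obtain ⟨e, he, rfl⟩ := hst
    -- With `s = e t = t f`, `f = t⁻¹ e t`, the first factor is `x t f`. Passing `f` to the second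
    -- factor has no effect there, because `a δ_t = a δ_{t f}` already absorbs it.
    rw [← T.toCrossed_delta_eq ⟨e, he, rfl⟩ ha, idem_mul_eq he, rightAct_mul, T.ind_rightAct (conj_idem t he)]
    congr 1
    rw [mul_assoc, mul_assoc, ← map_mul, mul_assoc t, (conj_idem t he).eq]

variable (X) in
/-- The right action of the crossed product on `X ⊗_{KE(S)} (A ⋊_θ S)`, as an algebra
homomorphism. -/
noncomputable def indRightHom : T.CrossedProductᵐᵒᵖ →ₐ[K] Module.End K (T.Ind X) :=
  AlgHom.opComm <| AlgHom.ofLinearMap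
    { toFun := T.indCrossed X
      map_add' := map_add _
      map_smul' := fun k b => by
        obtain ⟨f, rfl⟩ := T.toCrossed_surjective b
        rw [← toCrossed_smul]
        exact T.indSkew_smul k f }
    (map_one (T.indCrossed X)) (map_mul (T.indCrossed X))

theorem indRightHom_apply (a : A) (t : S) (x : X) (b : T.CrossedProduct) :
    T.indRightHom X (op (T.ofBase a * T.ofMonoid t)) (T.ind x b) =
      T.ind (rightAct (K := K) X t x) (b * (T.ofBase a * T.ofMonoid t)) := by
  rw [← toCrossed_delta]
  show unop (T.indSkew X (T.delta t a)) (T.ind x b) = _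
  have h : T.delta t (T.unit t * a) = T.delta t a :=
    Subtype.ext (congrArg (Finsupp.single t) (by rw [← mul_assoc, T.unit_mul_unit]))
  rw [indSkew_delta, unop_op, indRight_ind, ← toCrossed_delta, h]

/-- The map `x ⊗ b ↦ x ⊗ c b`. -/
noncomputable def indLeft (c : T.CrossedProduct) : Module.End K (T.Ind X) :=
  T.indOp 1 c 1 fun e _ => by rw [one_inv, one_mul, mul_one, one_mul, mul_one]

theorem indLeft_ind (c : T.CrossedProduct) (x : X) (b : T.CrossedProduct) :
    T.indLeft c (T.ind x b) = T.ind x (c * b) := by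
  rw [indLeft, indOp_ind, rightAct_one, mul_one]

variable (X) in
/-- The left action of the crossed product on `X ⊗_{KE(S)} (A ⋊_θ S)`. -/
noncomputable def indLeftHom : T.CrossedProduct →ₐ[K] Module.End K (T.Ind X) :=
  AlgHom.ofLinearMap
    { toFun := T.indLeft
      map_add' := fun c c' => Ind.hom_ext fun x b => by
        simp only [LinearMap.add_apply, indLeft_ind, add_mul, ind_add_right]
      map_smul' := fun k c => Ind.hom_ext fun x b => by
        simp only [LinearMap.smul_apply, RingHom.id_apply, indLeft_ind, smul_mul_assoc,
          ind_smul_right] }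
    (Ind.hom_ext fun x b => (T.indLeft_ind 1 x b).trans (congrArg (T.ind x) (one_mul b)))
    (fun c c' => Ind.hom_ext fun x b => by
      show T.indLeft (c * c') (T.ind x b) = T.indLeft c (T.indLeft c' (T.ind x b))
      simp only [indLeft_ind, mul_assoc])

noncomputable instance : Module T.CrossedProduct (T.Ind X) :=
  Module.compHom _ (T.indLeftHom X).toRingHom

noncomputable instance : Module T.CrossedProductᵐᵒᵖ (T.Ind X) :=
  Module.compHom _ (T.indRightHom X).toRingHom

theorem smul_ind (c : T.CrossedProduct) (x : X) (b : T.CrossedProduct) :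
    c • T.ind x b = T.ind x (c * b) := T.indLeft_ind c x b

theorem op_smul_ind (a : A) (t : S) (x : X) (b : T.CrossedProduct) :
    op (T.ofBase a * T.ofMonoid t) • T.ind x b =
      T.ind (rightAct (K := K) X t x) (b * (T.ofBase a * T.ofMonoid t)) :=
  T.indRightHom_apply a t x b

instance : IsScalarTower K T.CrossedProduct (T.Ind X) :=
  ⟨fun k c z => by
    show T.indLeftHom X (k • c) z = k • T.indLeftHom X c z
    rw [map_smul]; rfl⟩

instance : IsScalarTower K T.CrossedProductᵐᵒᵖ (T.Ind X) :=
  ⟨fun k c z => by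
    show T.indRightHom X (k • c) z = k • T.indRightHom X c z
    rw [map_smul]; rfl⟩

instance : SMulCommClass T.CrossedProduct T.CrossedProductᵐᵒᵖ (T.Ind X) :=
  ⟨fun c d z => by
    obtain ⟨d, rfl⟩ := op_surjective d
    induction d using T.crossedProduct_induction with
    | h0 => rw [op_zero, zero_smul, zero_smul, smul_zero]
    | ha d d' h h' => rw [MulOpposite.op_add, add_smul, add_smul, smul_add, h, h']
    | hs a t =>
      induction z using Ind.induction with
      | h0 => simp only [smul_zero]
      | hm x b => simp only [op_smul_ind, smul_ind, mul_assoc]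
      | ha z w hz hw => simp only [smul_add, hz, hw]⟩

end UnitalAction

namespace UnitalAction

attribute [local instance] envRightModule envRightModule_isScalarTower

/-! ### Induction `X ↦ X ⊗_{KE(S)} (A ⋊_θ S)` preserves injections -/

section Functoriality

variable {K S A : Type u} [Field K] [InverseMonoid S] [Ring A] [Algebra K A]
variable (T : UnitalAction K S A)
variable {X X' : Type u} [AddCommGroup X] [Module K X] [Module (MonoidAlgebra K S)ᵐᵒᵖ X]
  [IsScalarTower K (MonoidAlgebra K S)ᵐᵒᵖ X]
  [AddCommGroup X'] [Module K X'] [Module (MonoidAlgebra K S)ᵐᵒᵖ X']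
  [IsScalarTower K (MonoidAlgebra K S)ᵐᵒᵖ X']

/-- A map of right `KS`-modules, regarded as a map of `KE(S)`-modules. -/
noncomputable def idemRepMap (f : X →ₗ[(MonoidAlgebra K S)ᵐᵒᵖ] X') :
    (idemRep (K := K) (S := S) X).asModule →ₗ[MonoidAlgebra K (Idem S)]
      (idemRep (K := K) (S := S) X').asModule :=
  MonoidAlgebra.equivariantOfLinearOfComm
    (show (idemRep (K := K) (S := S) X).asModule →ₗ[K] (idemRep (K := K) (S := S) X').asModule from
      f.restrictScalars K) (by
      intro e x
      rw [Representation.single_smul, Representation.single_smul, one_smul, one_smul]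
      exact f.map_smul _ x)

/-- The `K`-linear map `f ⊗ (A ⋊_θ S)`. -/
noncomputable def indMapₗ (f : X →ₗ[(MonoidAlgebra K S)ᵐᵒᵖ] X') : T.Ind X →ₗ[K] T.Ind X' :=
  T.indLift (LinearMap.mk₂ K (fun x b => T.ind (f x) b)
      (fun x x' b => by rw [map_add, ind_add_left])
      (fun k x b => by
        rw [← ind_smul_left]
        exact congrArg (T.ind · b) ((f.restrictScalars K).map_smul k x))
      (fun x b b' => by rw [ind_add_right])
      (fun k x b => by rw [ind_smul_right]))
    (fun e he x b => by
      rw [LinearMap.mk₂_apply, LinearMap.mk₂_apply, ← T.ind_rightAct he, rightAct_apply,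
        rightAct_apply, map_smul])

theorem indMapₗ_ind (f : X →ₗ[(MonoidAlgebra K S)ᵐᵒᵖ] X') (x : X) (b : T.CrossedProduct) :
    T.indMapₗ f (T.ind x b) = T.ind (f x) b := rfl

/-- The crossed product is flat over `KE(S)`, as every `KE(S)`-module is. -/
theorem indMapₗ_injective {f : X →ₗ[(MonoidAlgebra K S)ᵐᵒᵖ] X'} (hf : Function.Injective f) :
    Function.Injective (T.indMapₗ f) := by
  have : Module.Flat (MonoidAlgebra K (Idem S)) T.idemRepCrossed.asModule := Idem.flat _
  have h := Module.Flat.rTensor_preserves_injective_linearMap (M := T.idemRepCrossed.asModule)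
    (idemRepMap f) hf
  have h' : ∀ z : T.Ind X, T.indMapₗ f z =
      LinearMap.rTensor T.idemRepCrossed.asModule (idemRepMap f) z := by
    intro z
    induction z using Ind.induction with
    | h0 => exact (map_zero (T.indMapₗ f)).trans (map_zero (LinearMap.rTensor _ _)).symm
    | hm x b => rfl
    | ha z w hz hw =>
      exact (map_add _ z w).trans ((congrArg₂ (· + ·) hz hw).trans
        (map_add (LinearMap.rTensor T.idemRepCrossed.asModule (idemRepMap f)) z w).symm)
  intro z w hzw
  rw [h', h'] at hzw
  exact h hzw

end Functoriality

/-! ### Tensoring with `Y / [A, Y]` over `KS` as a tensor product over the enveloping algebra -/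

section

variable {K S A : Type u} [CommRing K] [InverseMonoid S] [Ring A] [Algebra K A]
variable {T : UnitalAction K S A}
variable {X X' : Type u} [AddCommGroup X] [Module K X] [Module (MonoidAlgebra K S)ᵐᵒᵖ X]
  [IsScalarTower K (MonoidAlgebra K S)ᵐᵒᵖ X]

theorem env_induction {p : Env K T.CrossedProduct → Prop} (h0 : p 0)
    (ha : ∀ r r', p r → p r' → p (r + r'))
    (hm : ∀ a t d, p ((T.ofBase a * T.ofMonoid t) ⊗ₜ[K] op d)) (r : Env K T.CrossedProduct) :
    p r := by
  induction r using TensorProduct.induction_on with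
  | zero => exact h0
  | add r r' h h' => exact ha r r' h h'
  | tmul c d =>
    obtain ⟨d, rfl⟩ := op_surjective d
    induction c using T.crossedProduct_induction with
    | h0 => rw [TensorProduct.zero_tmul]; exact h0
    | ha c c' h h' => rw [TensorProduct.add_tmul]; exact ha _ _ h h'
    | hs a t => exact hm a t d

/-- Linearity over the enveloping algebra can be checked on the two actions. -/
theorem map_op_env_smul {P Q : Type u} [AddCommGroup P] [Module K P] [Module T.CrossedProduct P]
    [Module T.CrossedProductᵐᵒᵖ P] [SMulCommClass T.CrossedProduct T.CrossedProductᵐᵒᵖ P]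
    [IsScalarTower K T.CrossedProduct P] [IsScalarTower K T.CrossedProductᵐᵒᵖ P]
    [AddCommGroup Q] [Module K Q] [Module T.CrossedProduct Q]
    [Module T.CrossedProductᵐᵒᵖ Q] [SMulCommClass T.CrossedProduct T.CrossedProductᵐᵒᵖ Q]
    [IsScalarTower K T.CrossedProduct Q] [IsScalarTower K T.CrossedProductᵐᵒᵖ Q]
    (f : P →ₗ[K] Q) (hl : ∀ (c : T.CrossedProduct) z, f (c • z) = c • f z)
    (hr : ∀ (a : A) (t : S) z, f (op (T.ofBase a * T.ofMonoid t) • z) =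
      op (T.ofBase a * T.ofMonoid t) • f z)
    (r : (Env K T.CrossedProduct)ᵐᵒᵖ) (z : P) : f (r • z) = r • f z := by
  obtain ⟨r, rfl⟩ := op_surjective r
  induction r using env_induction with
  | h0 =>
    have h1 : op (0 : Env K T.CrossedProduct) • z = 0 := zero_smul (Env K T.CrossedProduct)ᵐᵒᵖ z
    have h2 : op (0 : Env K T.CrossedProduct) • f z = 0 :=
      zero_smul (Env K T.CrossedProduct)ᵐᵒᵖ (f z)
    exact (congrArg f h1).trans ((map_zero f).trans h2.symm)
  | ha r r' h h' => rw [MulOpposite.op_add, add_smul, add_smul, map_add, h, h']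
  | hm a t d => rw [envRightModule_smul, envRightModule_smul, hl, hr]

theorem op_ofBase_smul_ind (a : A) (x : X) (b : T.CrossedProduct) :
    op (T.ofBase a) • T.ind x b = T.ind x (b * T.ofBase a) := by
  have h := T.op_smul_ind a 1 x b
  rwa [map_one, mul_one, rightAct_one] at h

theorem op_ofMonoid_smul_ind (t : S) (x : X) (b : T.CrossedProduct) :
    op (T.ofMonoid t) • T.ind x b = T.ind (rightAct (K := K) X t x) (b * T.ofMonoid t) := by
  have h := T.op_smul_ind 1 t x b
  rwa [← ofBaseHom_apply, map_one, one_mul] at h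

attribute [local instance] algebraModule algebraModule_isScalarTower

variable (Y Z : ModuleCat.{u} (Env K T.CrossedProduct))

variable (X) in
/-- The bilinear map `(x, [y]) ↦ (x ⊗ 1) ⊗ y`. -/
noncomputable def tensorCoinvAux : X →ₗ[K] T.coinvFunctor.obj Y →ₗ[K]
    BalancedTensor K (Env K T.CrossedProduct) (T.Ind X) Y :=
  LinearMap.mk₂ K (fun x z => coinvLift
      (BalancedTensor.mkₗ K (Env K T.CrossedProduct) (Y := Y) (T.ind x 1)) (fun a y => by
        -- Left and right multiplication by `a` agree on `x ⊗ 1`, both giving `x ⊗ a`; so a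
        -- commutator applied to `y` can be moved across and vanishes.
        rw [BalancedTensor.mkₗ_apply, ← BalancedTensor.mk_smul, comm, MulOpposite.op_sub,
          sub_smul, ← op_one, envRightModule_smul, envRightModule_smul, op_one, one_smul,
          one_smul, op_ofBase_smul_ind, smul_ind, one_mul, mul_one, sub_self,
          BalancedTensor.mk_zero_left]) z)
    (fun x x' z => by
      obtain ⟨y, rfl⟩ := coinvMk_surjective z
      simp only [coinvLift_mk, ind_add_left, map_add, LinearMap.add_apply])
    (fun k x z => by
      obtain ⟨y, rfl⟩ := coinvMk_surjective z
      simp only [coinvLift_mk, ind_smul_left, map_smul, LinearMap.smul_apply])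
    (fun x z z' => map_add _ _ _) (fun k x z => map_smul _ _ _)

theorem tensorCoinvAux_mk (x : X) (y : Y) : tensorCoinvAux X Y x (coinvMk y) =
    BalancedTensor.mk K (Env K T.CrossedProduct) (T.ind x 1) y := rfl

/-- Moving `δ_s ⊗ δ_{s⁻¹}` onto `x ⊗ 1` gives `δ_{s⁻¹} (x ⊗ 1) δ_s = x s ⊗ δ_{s⁻¹ s}`. The
idempotent `s⁻¹ s` returns to the first factor, where `s s⁻¹ s = s` absorbs it, leaving `x s ⊗ 1`.
-/
theorem tensorCoinvAux_single_smul (s : S) (k : K) (x : X) (z : T.coinvFunctor.obj Y) :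
    tensorCoinvAux X Y ((op (MonoidAlgebra.single s k) : (MonoidAlgebra K S)ᵐᵒᵖ) • x) z =
      tensorCoinvAux X Y x (MonoidAlgebra.single s k • z) := by
  obtain ⟨y, rfl⟩ := coinvMk_surjective z
  have h1 : (op (MonoidAlgebra.single s k) : (MonoidAlgebra K S)ᵐᵒᵖ) • x =
      k • rightAct (K := K) X s x := by
    rw [rightAct_apply, ← smul_assoc, ← MulOpposite.op_smul, MonoidAlgebra.smul_single,
      smul_eq_mul, mul_one]
  have h2 : MonoidAlgebra.single s k • coinvMk (T := T) y =
      k • coinvMk (T := T) (T.conjHom s • y) := by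
    rw [smul_coinvMk, conjAlgHom_single, ← coinvMk_smul, smul_assoc]
  rw [h1, h2, map_smul, map_smul, LinearMap.smul_apply]
  congr 1
  rw [tensorCoinvAux_mk, tensorCoinvAux_mk, ← BalancedTensor.mk_smul, conjHom_apply,
    envRightModule_smul, op_ofMonoid_smul_ind,
    smul_ind, one_mul, ← map_mul, ← one_mul (T.ofMonoid (s⁻¹ * s)),
    ← T.ind_rightAct (inv_mul_idem s), ← rightAct_mul, ← mul_assoc, mul_inv_mul]

theorem tensorCoinvAux_smul (r : MonoidAlgebra K S) (x : X) (z : T.coinvFunctor.obj Y) :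
    tensorCoinvAux X Y (op r • x) z = tensorCoinvAux X Y x (r • z) := by
  induction r using MonoidAlgebra.induction_linear with
  | zero =>
    have h1 : op (0 : MonoidAlgebra K S) • x = 0 := zero_smul (MonoidAlgebra K S)ᵐᵒᵖ x
    have h2 : (0 : MonoidAlgebra K S) • z = 0 := zero_smul (MonoidAlgebra K S) z
    exact (congrArg (tensorCoinvAux X Y · z) h1).trans
      ((LinearMap.congr_fun (map_zero (tensorCoinvAux X Y)) z).trans
        ((congrArg (tensorCoinvAux X Y x) h2).trans (map_zero _)).symm)
  | add r r' h h' =>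
    rw [MulOpposite.op_add, add_smul, add_smul, map_add, map_add, LinearMap.add_apply, h, h']
  | single s k => exact tensorCoinvAux_single_smul Y s k x z

variable (X) in
/-- The isomorphism `X ⊗_{KS} Y / [A, Y] → (X ⊗_{KE(S)} (A ⋊_θ S)) ⊗ Y`, where the right tensor
product is over the enveloping algebra. -/
noncomputable def tensorCoinv :
    BalancedTensor K (MonoidAlgebra K S) X (T.coinvFunctor.obj Y) →ₗ[K]
      BalancedTensor K (Env K T.CrossedProduct) (T.Ind X) Y :=
  BalancedTensor.lift K (MonoidAlgebra K S) (tensorCoinvAux X Y)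
    fun x r z => tensorCoinvAux_smul Y r x z

theorem tensorCoinv_mk (x : X) (y : Y) :
    tensorCoinv X Y (BalancedTensor.mk K (MonoidAlgebra K S) x (coinvMk y)) =
      BalancedTensor.mk K (Env K T.CrossedProduct) (T.ind x 1) y := rfl

/-- Since `x ⊗ b = b (x ⊗ 1)`, the factor `b` can be transferred to `y`: the element `(x ⊗ b) ⊗ y`
equals `(x ⊗ 1) ⊗ y b`. -/
theorem tensorCoinv_surjective : Function.Surjective (tensorCoinv X Y) := by
  intro z
  induction z using BalancedTensor.induction with
  | h0 => exact ⟨0, map_zero _⟩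
  | hm z y =>
    induction z using Ind.induction with
    | h0 => exact ⟨0, by rw [map_zero, BalancedTensor.mk_zero_left]⟩
    | hm x b =>
      refine ⟨BalancedTensor.mk K _ x
        (coinvMk ((1 ⊗ₜ[K] op b : Env K T.CrossedProduct) • y)), ?_⟩
      rw [tensorCoinv_mk, ← BalancedTensor.mk_smul, envRightModule_smul, op_one, one_smul,
        smul_ind, mul_one]
    | ha z w hz hw =>
      obtain ⟨z', hz⟩ := hz
      obtain ⟨w', hw⟩ := hw
      exact ⟨z' + w', by rw [map_add, hz, hw, BalancedTensor.mk_add_left]⟩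
  | ha z w hz hw =>
    obtain ⟨z, rfl⟩ := hz
    obtain ⟨w, rfl⟩ := hw
    exact ⟨z + w, map_add _ _ _⟩

/-- The map `x ⊗ b ↦ x ⊗ [y b]`. -/
noncomputable def tensorCoinvInvAux (y : Y) :
    T.Ind X →ₗ[K] BalancedTensor K (MonoidAlgebra K S) X (T.coinvFunctor.obj Y) :=
  T.indLift (LinearMap.mk₂ K (fun x b => BalancedTensor.mk K (MonoidAlgebra K S) x
        (coinvMk ((1 ⊗ₜ[K] op b : Env K T.CrossedProduct) • y)))
      (fun x x' b => BalancedTensor.mk_add_left _ _ _ _ _)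
      (fun k x b => BalancedTensor.mk_smul_left _ _ _ _ _)
      (fun x b b' => by
        rw [MulOpposite.op_add, TensorProduct.tmul_add, add_smul, coinvMk_add,
          BalancedTensor.mk_add_right])
      (fun k x b => by
        rw [MulOpposite.op_smul, TensorProduct.tmul_smul, smul_assoc, coinvMk_smul,
          BalancedTensor.mk_smul_right]))
    (fun e he x b => by
      rw [LinearMap.mk₂_apply, LinearMap.mk₂_apply, rightAct_apply, BalancedTensor.mk_smul,
        smul_coinvMk, conjAlgHom_single, one_smul, conjHom_apply, inv_idem he, ← mul_smul,
        Algebra.TensorProduct.tmul_mul_tmul, mul_one, ← op_mul]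
      congr 1
      -- What remains is `[δ_e y b δ_e] = [y b δ_e]`. Here `δ_e` comes from `A`, so the left copy
      -- moves to the right modulo commutators and merges with the one there.
      have h := coinvMk_comm (T := T) (T.unit e)
        ((1 ⊗ₜ[K] op (b * T.ofMonoid e) : Env K T.CrossedProduct) • y)
      rw [← T.ofMonoid_idem he, ← mul_smul, ← mul_smul, Algebra.TensorProduct.tmul_mul_tmul,
        Algebra.TensorProduct.tmul_mul_tmul, one_mul, mul_one, one_mul, ← op_mul, mul_assoc,
        ← map_mul, he.eq] at h
      exact h)

theorem tensorCoinvInvAux_ind (x : X) (b : T.CrossedProduct) (y : Y) :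
    tensorCoinvInvAux Y y (T.ind x b) = BalancedTensor.mk K (MonoidAlgebra K S) x
      (coinvMk ((1 ⊗ₜ[K] op b : Env K T.CrossedProduct) • y)) := rfl

theorem tensorCoinvInvAux_add (y y' : Y) (z : T.Ind X) :
    tensorCoinvInvAux Y (y + y') z = tensorCoinvInvAux Y y z + tensorCoinvInvAux Y y' z := by
  refine LinearMap.congr_fun (g := tensorCoinvInvAux Y y + tensorCoinvInvAux Y y')
    (Ind.hom_ext fun x b => ?_) z
  rw [LinearMap.add_apply, tensorCoinvInvAux_ind, tensorCoinvInvAux_ind,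
    tensorCoinvInvAux_ind, smul_add, coinvMk_add, BalancedTensor.mk_add_right]

theorem tensorCoinvInvAux_smul (k : K) (y : Y) (z : T.Ind X) :
    tensorCoinvInvAux Y (k • y) z = k • tensorCoinvInvAux Y y z := by
  refine LinearMap.congr_fun (g := k • tensorCoinvInvAux Y y) (Ind.hom_ext fun x b => ?_) z
  rw [LinearMap.smul_apply, tensorCoinvInvAux_ind, tensorCoinvInvAux_ind,
    smul_algebra_smul_comm, coinvMk_smul, BalancedTensor.mk_smul_right]

/-- The left side is the class of `δ_t y c a δ_{t t⁻¹}`. The idempotent `δ_{t t⁻¹}` lies in the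
image of `A`, so it cycles to the front and is absorbed by `δ_t`; then `a` cycles likewise. -/
theorem coinvMk_conjHom_smul (a : A) (t : S) (c : T.CrossedProduct) (y : Y) :
    coinvMk (T := T) (T.conjHom t •
        (1 ⊗ₜ[K] op (c * (T.ofBase a * T.ofMonoid t)) : Env K T.CrossedProduct) • y) =
      coinvMk (((T.ofBase a * T.ofMonoid t) ⊗ₜ[K] op c : Env K T.CrossedProduct) • y) := by
  have h1 := coinvMk_comm (T := T) (T.unit (t * t⁻¹))
    ((T.ofMonoid t ⊗ₜ[K] op (c * T.ofBase a) : Env K T.CrossedProduct) • y)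
  have h2 := coinvMk_comm (T := T) a
    ((T.ofMonoid t ⊗ₜ[K] op c : Env K T.CrossedProduct) • y)
  rw [← mul_smul, ← mul_smul, Algebra.TensorProduct.tmul_mul_tmul,
    Algebra.TensorProduct.tmul_mul_tmul, one_mul, one_mul, ← op_mul] at h1 h2
  rw [← T.ofMonoid_idem (mul_inv_idem t), ← map_mul, mul_inv_mul] at h1
  rw [h2, h1, ← mul_smul, conjHom_apply, Algebra.TensorProduct.tmul_mul_tmul, mul_one, ← op_mul,
    map_mul]
  simp only [mul_assoc]

theorem tensorCoinvInvAux_op_smul (r : Env K T.CrossedProduct) (y : Y) (z : T.Ind X) :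
    tensorCoinvInvAux Y y (op r • z) = tensorCoinvInvAux Y (r • y) z := by
  induction r using env_induction with
  | h0 =>
    have h1 : op (0 : Env K T.CrossedProduct) • z = 0 := zero_smul (Env K T.CrossedProduct)ᵐᵒᵖ z
    have h2 : (0 : Env K T.CrossedProduct) • y = 0 := zero_smul (Env K T.CrossedProduct) y
    have h3 := tensorCoinvInvAux_smul (T := T) Y (0 : K) 0 z
    have h4 : (0 : K) • tensorCoinvInvAux Y 0 z = 0 := zero_smul K _
    have h5 : (0 : K) • (0 : Y) = 0 := smul_zero _
    exact (congrArg (tensorCoinvInvAux Y y) h1).trans ((map_zero _).trans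
      ((congrArg (tensorCoinvInvAux Y · z) (h2.trans h5.symm)).trans (h3.trans h4)).symm)
  | ha r r' h h' =>
    rw [MulOpposite.op_add, add_smul, add_smul, map_add, h, h', tensorCoinvInvAux_add]
  | hm a t d =>
    induction z using Ind.induction with
    | h0 => rw [smul_zero, map_zero, map_zero]
    | ha z w hz hw => rw [smul_add, map_add, hz, hw, map_add]
    | hm x b =>
      rw [envRightModule_smul, op_smul_ind, smul_ind, tensorCoinvInvAux_ind,
        tensorCoinvInvAux_ind, rightAct_apply, BalancedTensor.mk_smul, smul_coinvMk,
        conjAlgHom_single, one_smul, ← mul_assoc, coinvMk_conjHom_smul, ← mul_smul,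
        Algebra.TensorProduct.tmul_mul_tmul, one_mul, ← op_mul]

variable (X) in
/-- The inverse of `tensorCoinv`. -/
noncomputable def tensorCoinvInv :
    BalancedTensor K (Env K T.CrossedProduct) (T.Ind X) Y →ₗ[K]
      BalancedTensor K (MonoidAlgebra K S) X (T.coinvFunctor.obj Y) :=
  BalancedTensor.lift K (Env K T.CrossedProduct)
    (LinearMap.mk₂ K (fun z y => tensorCoinvInvAux Y y z)
      (fun _ _ _ => map_add _ _ _) (fun _ _ _ => map_smul _ _ _)
      (fun z y y' => tensorCoinvInvAux_add Y y y' z)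
      (fun k z y => tensorCoinvInvAux_smul Y k y z))
    fun z r y => tensorCoinvInvAux_op_smul Y r y z

theorem tensorCoinvInv_mk (x : X) (b : T.CrossedProduct) (y : Y) :
    tensorCoinvInv X Y (BalancedTensor.mk K (Env K T.CrossedProduct) (T.ind x b) y) =
      BalancedTensor.mk K (MonoidAlgebra K S) x
        (coinvMk ((1 ⊗ₜ[K] op b : Env K T.CrossedProduct) • y)) := rfl

theorem tensorCoinv_bijective : Function.Bijective (tensorCoinv (T := T) X Y) := by
  refine ⟨?_, tensorCoinv_surjective Y⟩
  -- Only this composite need be checked, and only on `x ⊗ [y]`, where it amounts to `[y · 1] =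
  -- [y]`.
  refine Function.LeftInverse.injective (g := tensorCoinvInv X Y) fun z => ?_
  induction z using BalancedTensor.induction with
  | h0 => rw [map_zero, map_zero]
  | ha z w hz hw => rw [map_add, map_add, hz, hw]
  | hm x z =>
    obtain ⟨y, rfl⟩ := coinvMk_surjective z
    rw [tensorCoinv_mk, tensorCoinvInv_mk, op_one, ← Algebra.TensorProduct.one_def, one_smul]

end

end UnitalAction

namespace UnitalAction

attribute [local instance] envRightModule envRightModule_isScalarTower
attribute [local instance] algebraModule algebraModule_isScalarTower

/-! ### Passing to `Y / [A, Y]` preserves flatness -/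

section Functoriality

variable {K S A : Type u} [Field K] [InverseMonoid S] [Ring A] [Algebra K A]
variable (T : UnitalAction K S A)
variable {X X' : Type u} [AddCommGroup X] [Module K X] [Module (MonoidAlgebra K S)ᵐᵒᵖ X]
  [IsScalarTower K (MonoidAlgebra K S)ᵐᵒᵖ X]
  [AddCommGroup X'] [Module K X'] [Module (MonoidAlgebra K S)ᵐᵒᵖ X']
  [IsScalarTower K (MonoidAlgebra K S)ᵐᵒᵖ X']

/-- The map `f ⊗ (A ⋊_θ S)` is a map of bimodules. -/
noncomputable def indMap (f : X →ₗ[(MonoidAlgebra K S)ᵐᵒᵖ] X') :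
    T.Ind X →ₗ[(Env K T.CrossedProduct)ᵐᵒᵖ] T.Ind X' where
  toFun := T.indMapₗ f
  map_add' := map_add _
  map_smul' := map_op_env_smul (T.indMapₗ f)
    (fun c z => by
      induction z using Ind.induction with
      | h0 => simp only [smul_zero, map_zero]
      | hm x b => simp only [smul_ind, indMapₗ_ind]
      | ha z w hz hw => simp only [smul_add, map_add, hz, hw])
    (fun a t z => by
      induction z using Ind.induction with
      | h0 => simp only [smul_zero, map_zero]
      | hm x b => simp only [op_smul_ind, indMapₗ_ind, rightAct_apply, map_smul]
      | ha z w hz hw => simp only [smul_add, map_add, hz, hw])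

/-- By naturality of `tensorCoinv` in `X`, tensoring with `Q / [A, Q]` is induction to bimodules
followed by tensoring with `Q`; both steps preserve injectivity. -/
theorem isTensorFlat_coinvFunctor_obj {Q : ModuleCat.{u} (Env K T.CrossedProduct)}
    (hQ : IsTensorFlat K (Env K T.CrossedProduct) Q) :
    IsTensorFlat K (MonoidAlgebra K S) (T.coinvFunctor.obj Q) := by
  intro X X' _ _ _ _ _ _ _ _ f hf
  have h : ∀ z, tensorCoinv X' Q (BalancedTensor.mapLeft K (MonoidAlgebra K S)
      (T.coinvFunctor.obj Q) f z) = BalancedTensor.mapLeft K (Env K T.CrossedProduct) Q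
        (T.indMap f) (tensorCoinv X Q z) := by
    intro z
    induction z using BalancedTensor.induction with
    | h0 => simp only [map_zero]
    | ha z w hz hw => simp only [map_add, hz, hw]
    | hm x z =>
      obtain ⟨y, rfl⟩ := coinvMk_surjective z
      rfl
  have hi := hQ (T.Ind X) (T.Ind X') (T.indMap f) (T.indMapₗ_injective hf)
  refine Function.Injective.of_comp (f := tensorCoinv X' Q) ?_
  rw [show tensorCoinv X' Q ∘ _ = _ from funext h]
  exact hi.comp (tensorCoinv_bijective Q).injective

end Functoriality

/-! ### The case `X = KE(S)`: the induced bimodule is the crossed product -/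

variable {K S A : Type u} [CommRing K] [InverseMonoid S] [Ring A] [Algebra K A]
variable (T : UnitalAction K S A)

theorem rightAct_single {t : S} {e : {e : S // IsIdempotentElem e}} (k : K) :
    rightAct (K := K) (KE K S) t (Finsupp.single e k) = Finsupp.single (conjIdem t e) k := by
  rw [rightAct_apply, KE_op_single_smul, one_mul]

/-- The isomorphism `b ↦ 1 ⊗ b` from `A ⋊_θ S` to `KE(S) ⊗_{KE(S)} (A ⋊_θ S)`, as a `K`-linear
map. -/
noncomputable def toIndₗ : T.CrossedProduct →ₗ[K] T.Ind (KE K S) where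
  toFun b := T.ind (Finsupp.single ⟨1, .one⟩ 1) b
  map_add' b b' := T.ind_add_right _ b b'
  map_smul' k b := T.ind_smul_right k _ b

theorem toIndₗ_apply (b : T.CrossedProduct) :
    T.toIndₗ b = T.ind (Finsupp.single ⟨1, .one⟩ 1) b := rfl

/-- As `e = 1 · e` in `KE(S)`, the idempotent crosses the tensor sign: `KE(S)` is free of rank one
over itself, with generator the idempotent `1`. -/
theorem ind_single (e : {e : S // IsIdempotentElem e}) (k : K) (b : T.CrossedProduct) :
    T.ind (Finsupp.single e k : KE K S) b = T.toIndₗ (k • (b * T.ofMonoid e)) := by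
  have h : (Finsupp.single e k : KE K S) =
      k • rightAct (K := K) (KE K S) (e : S) (Finsupp.single ⟨1, .one⟩ 1) := by
    rw [rightAct_single, Finsupp.smul_single, smul_eq_mul, mul_one]
    congr 1
    refine Subtype.ext ?_
    show (e : S) = (e : S)⁻¹ * 1 * e
    rw [mul_one, inv_idem e.2, e.2.eq]
  rw [h, ind_smul_left, T.ind_rightAct e.2, map_smul, toIndₗ_apply]

theorem toIndₗ_surjective : Function.Surjective T.toIndₗ := by
  intro z
  induction z using Ind.induction with
  | h0 => exact ⟨0, map_zero _⟩
  | ha z w hz hw =>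
    obtain ⟨z, rfl⟩ := hz
    obtain ⟨w, rfl⟩ := hw
    exact ⟨z + w, map_add _ _ _⟩
  | hm x b =>
    induction x using Finsupp.induction_linear with
    | zero => exact ⟨0, by rw [map_zero, ← zero_smul K (0 : KE K S), ind_smul_left, zero_smul]⟩
    | add x x' hx hx' =>
      obtain ⟨c, hc⟩ := hx
      obtain ⟨c', hc'⟩ := hx'
      exact ⟨c + c', by rw [map_add, hc, hc', ind_add_left]⟩
    | single e k => exact ⟨_, (T.ind_single e k b).symm⟩

/-- The map `e ⊗ b ↦ b δ_e`. -/
noncomputable def ofInd : T.Ind (KE K S) →ₗ[K] T.CrossedProduct :=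
  T.indLift (Finsupp.lsum K fun e => LinearMap.toSpanSingleton K _
      (LinearMap.mulRight K (T.ofMonoid (e : S)))) (by
    intro e he x b
    induction x using Finsupp.induction_linear with
    | zero => simp only [map_zero, LinearMap.zero_apply]
    | add x x' hx hx' => simp only [map_add, LinearMap.add_apply, hx, hx']
    | single f k =>
      rw [rightAct_single, Finsupp.lsum_single, Finsupp.lsum_single]
      simp only [LinearMap.toSpanSingleton_apply, LinearMap.smul_apply, LinearMap.mulRight_apply]
      rw [mul_assoc, ← map_mul]
      congr 3
      show e⁻¹ * (f : S) * e = e * f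
      rw [inv_idem he, mul_assoc, idem_comm f.2 he, ← mul_assoc, he.eq])

theorem ofInd_toIndₗ (b : T.CrossedProduct) : T.ofInd (T.toIndₗ b) = b := by
  rw [toIndₗ_apply, ofInd, indLift_ind, Finsupp.lsum_single]
  simp only [LinearMap.toSpanSingleton_apply, LinearMap.mulRight_apply, one_smul,
    map_one, mul_one]

/-- The map `b ↦ 1 ⊗ b` as a map of bimodules. -/
noncomputable def toInd : T.CrossedProduct →ₗ[(Env K T.CrossedProduct)ᵐᵒᵖ] T.Ind (KE K S) where
  toFun := T.toIndₗ
  map_add' := map_add _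
  map_smul' := map_op_env_smul T.toIndₗ
    (fun c b => by rw [toIndₗ_apply, toIndₗ_apply, smul_ind, smul_eq_mul])
    (fun a t b => by
      -- The diagonal action sends the generator `1` to `t⁻¹ t` rather than fixing it. Moved to the
      -- second factor, `t⁻¹ t` is absorbed by `a δ_t`.
      have h : (conjIdem t ⟨1, .one⟩ : {e : S // IsIdempotentElem e}) =
        ⟨t⁻¹ * t, inv_mul_idem t⟩ := Subtype.ext (by simp only [conjIdem, mul_one])
      rw [op_smul_eq_mul, toIndₗ_apply T b, op_smul_ind, rightAct_single, h, ind_single, one_smul,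
        mul_assoc, mul_assoc, ← map_mul, ← mul_assoc t, mul_inv_mul])

/-- The inverse of `toInd`. -/
noncomputable def toIndEquiv :
    T.CrossedProduct ≃ₗ[(Env K T.CrossedProduct)ᵐᵒᵖ] T.Ind (KE K S) :=
  LinearEquiv.ofBijective T.toInd
    ⟨Function.LeftInverse.injective (g := T.ofInd) T.ofInd_toIndₗ, T.toIndₗ_surjective⟩

theorem mapLeft_toInd_bijective (Y : ModuleCat.{u} (Env K T.CrossedProduct)) :
    Function.Bijective (BalancedTensor.mapLeft K (Env K T.CrossedProduct) Y T.toInd) := by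
  refine ⟨?_, BalancedTensor.mapLeft_surjective K _ T.toIndₗ_surjective⟩
  refine Function.LeftInverse.injective
    (g := BalancedTensor.mapLeft K (Env K T.CrossedProduct) Y T.toIndEquiv.symm.toLinearMap)
    fun z => ?_
  induction z using BalancedTensor.induction with
  | h0 => simp only [map_zero]
  | ha z w hz hw => simp only [map_add, hz, hw]
  | hm b y =>
    rw [BalancedTensor.mapLeft_mk, BalancedTensor.mapLeft_mk]
    exact congrArg (BalancedTensor.mk K _ · y) (T.toIndEquiv.symm_apply_apply b)

/-- The isomorphism `KE(S) ⊗_{KS} Y / [A, Y] ≅ (A ⋊_θ S) ⊗ Y`, where the right tensor product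
is over the enveloping algebra. -/
noncomputable def coinvTensorIso :
    T.coinvFunctor ⋙ balancedTensorFunctor K (MonoidAlgebra K S) (KE K S) ≅
      balancedTensorFunctor K (Env K T.CrossedProduct) T.CrossedProduct :=
  let e : T.coinvFunctor ⋙ balancedTensorFunctor K (MonoidAlgebra K S) (KE K S) ≅
      balancedTensorFunctor K (Env K T.CrossedProduct) (T.Ind (KE K S)) :=
    NatIso.ofComponents (fun Y => (LinearEquiv.ofBijective (tensorCoinv (T := T) (KE K S) Y)
      (tensorCoinv_bijective Y)).toModuleIso) (by
      intro Y Z f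
      ext : 1
      refine BalancedTensor.hom_ext fun x z => ?_
      obtain ⟨y, rfl⟩ := coinvMk_surjective z
      rfl)
  let e' : balancedTensorFunctor K (Env K T.CrossedProduct) T.CrossedProduct ≅
      balancedTensorFunctor K (Env K T.CrossedProduct) (T.Ind (KE K S)) :=
    NatIso.ofComponents (fun Y => (LinearEquiv.ofBijective _
      (T.mapLeft_toInd_bijective Y)).toModuleIso)
      (fun f => (balancedTensorFunctorMap K (Env K T.CrossedProduct) T.toInd).naturality f)
  e ≪≫ e'.symm

/-! ### Comparison of the two descriptions of `M / [A, M]` -/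

section

attribute [-instance] envRightModule envRightModule_isScalarTower algebraModule
  algebraModule_isScalarTower
attribute [local instance] envLeftModule

variable (M : Type u) [AddCommGroup M] [Module K M] [Module T.CrossedProduct M]
    [Module T.CrossedProductᵐᵒᵖ M] [SMulCommClass T.CrossedProduct T.CrossedProductᵐᵒᵖ M]
    [IsScalarTower K T.CrossedProduct M] [IsScalarTower K T.CrossedProductᵐᵒᵖ M]

/-- The given `K`-structure on `M` agrees with the one restricted from the enveloping algebra, so
both can be used interchangeably. -/
theorem env_algebraMap_smul (k : K) (x : M) :
    algebraMap K (Env K T.CrossedProduct) k • x = k • x := by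
  rw [Algebra.TensorProduct.algebraMap_apply, ← op_one, envLeftModule_smul, op_one, one_smul,
    algebraMap_smul]

theorem conjAlgHom_single_smul (s : S) (k : K) (x : M) :
    T.conjAlgHom (MonoidAlgebra.single s k) • x = k • T.bimoduleRep M s x := by
  rw [conjAlgHom_single, Algebra.smul_def k (T.conjHom s), mul_smul, env_algebraMap_smul, conjHom_apply,
    envLeftModule_smul, bimoduleRep_apply]

theorem comm_smul (a : A) (x : M) :
    T.comm a • x = T.ofBase a • x - op (T.ofBase a) • x := by
  rw [comm, sub_smul, ← op_one, envLeftModule_smul, envLeftModule_smul, op_one, one_smul, one_smul]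

theorem commSubgroup_eq_commutators :
    T.commSubgroup M = (T.commutators M).toAddSubgroup := by
  refine le_antisymm (T.commSubgroup_le fun a x => ?_) ?_
  · rw [comm_smul]
    exact Submodule.subset_span ⟨a, x, rfl⟩
  · intro z hz
    refine Submodule.span_induction (p := fun z _ => z ∈ T.commSubgroup M) ?_
      (AddSubgroup.zero_mem _) (fun _ _ _ _ => AddSubgroup.add_mem _) ?_ hz
    · rintro _ ⟨a, x, rfl⟩
      rw [← comm_smul]
      exact T.comm_smul_mem a x
    · intro k z _ hz
      -- Scalars of `K` are elements of `KS`, under which the additive subgroup is already stable;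
      -- so it contains the `K`-span.
      have h := T.conjAlgHom_smul_mem (algebraMap K _ k) hz
      rw [AlgHom.commutes] at h
      rwa [env_algebraMap_smul] at h

/-- The projection `M → M / [A, M]`. -/
noncomputable def coinvariantsMk : T.conjRestrict.obj (ModuleCat.of (Env K T.CrossedProduct) M)
    →ₗ[MonoidAlgebra K S] T.coinvariants M where
  toFun x := (T.commutators M).mkQ x
  map_add' x y := map_add (T.commutators M).mkQ x y
  map_smul' r x := by
    let ρ := (T.bimoduleRep M).quotient (T.commutators M) (T.commutators_le_comap M)
    suffices h : ∀ x : M, (T.commutators M).mkQ (T.conjAlgHom r • x) =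
        r • (show ρ.asModule from (T.commutators M).mkQ x) from h x
    intro x
    induction r using MonoidAlgebra.induction_linear with
    | zero =>
      have h1 : T.conjAlgHom 0 • x = 0 := by
        rw [map_zero]
        exact zero_smul (Env K T.CrossedProduct) x
      have h2 : (0 : MonoidAlgebra K S) • (show ρ.asModule from (T.commutators M).mkQ x) = 0 :=
        zero_smul (MonoidAlgebra K S) _
      exact (congrArg _ h1).trans ((map_zero _).trans h2.symm)
    | add r r' h h' =>
      rw [map_add, add_smul, map_add, h, h']
      exact (add_smul r r' (show ρ.asModule from (T.commutators M).mkQ x)).symm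
    | single s k =>
      rw [conjAlgHom_single_smul, map_smul, Representation.single_smul]
      rfl

/-- For a bimodule `M`, the two constructions of `M / [A, M]` agree. -/
noncomputable def coinvariantsIso :
    T.coinvFunctor.obj (ModuleCat.of (Env K T.CrossedProduct) M) ≅ T.coinvariants M :=
  LinearEquiv.toModuleIso <|
    (Submodule.quotEquivOfEq _ _ (by
      ext x
      refine Iff.trans ?_ (Submodule.Quotient.mk_eq_zero (T.commutators M)).symm
      exact iff_of_eq (congrArg (x ∈ ·) (T.commSubgroup_eq_commutators M)))).trans
    ((T.coinvariantsMk M).quotKerEquivOfSurjective (Submodule.mkQ_surjective (T.commutators M)))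

end

end UnitalAction

/-! ### The main isomorphism -/

theorem mainTheorem9 {K S A : Type u} [Field K] [InverseMonoid S] [Ring A] [Algebra K A]
    (T : UnitalAction K S A) (hA : IsSeparableAlgebra K A)
    (M : Type u) [AddCommGroup M] [Module K M] [Module T.CrossedProduct M]
    [Module T.CrossedProductᵐᵒᵖ M] [SMulCommClass T.CrossedProduct T.CrossedProductᵐᵒᵖ M]
    [IsScalarTower K T.CrossedProduct M] [IsScalarTower K T.CrossedProductᵐᵒᵖ M] (n : ℕ) :
    Nonempty (inverseMonoidHomology K S (T.coinvariants M) n ≃ₗ[K]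
      hochschildHomology K T.CrossedProduct M n) := by
  let := envLeftModule K T.CrossedProduct M
  let := envRightModule K T.CrossedProduct T.CrossedProduct
  have := envRightModule_isScalarTower K T.CrossedProduct T.CrossedProduct
  have := T.coinvFunctor_preservesHomology hA
  -- The derived functors of `KE(S) ⊗_{KS} F(-)` are those of `B ⊗_{B^e} -`, hence Hochschild
  -- homology. It then remains only to replace `F(M)` by `M / [A, M]` with its conjugation action.
  obtain ⟨i⟩ := nonempty_algebraTor_iso_leftDerived (KE K S) T.coinvFunctor
    (fun Q _ => T.isTensorFlat_coinvFunctor_obj (isTensorFlat_of_projective K _ Q))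
    (balancedTensorFunctor K (Env K T.CrossedProduct) T.CrossedProduct) T.coinvTensorIso
    (ModuleCat.of (Env K T.CrossedProduct) M) n
  exact ⟨((((balancedTensorFunctor K (MonoidAlgebra K S) (KE K S)).leftDerived n).mapIso
    (T.coinvariantsIso M)).symm ≪≫ i).toLinearEquiv⟩
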